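/- \textbf{Theorem (Large deviation principles and pressure representation).} Let $d\ge 1$, $\beta>0$, $\alpha<0$, $\mu\in\mathbb{R}$ and $a>b>0$. \emph{Ideal Bose gas.} For $k\in\mathbb{N}=\{1,2,\dots\}$ and $s\in\mathbb{R}$ put $$q_k=\frac{1}{(4\pi\beta)^{d/2}k^{1+d/2}},\qquad \overline q^{(s)}=\sum_{k\ge 1}q_k e^{\beta s k}\in[0,\infty],\qquad p_0(\beta,s)=\frac1\beta\,\overline q^{(s)},\qquad f_0(\beta,x)=\sup_{s\in\mathbb{R}}\{s x-p_0(\beta,s)\}\quad(x\ge 0).$$ \emph{Spatial cycle Huang--Yang--Luttinger (HYL) model.} Let $\Lambda\subset\mathbb{R}^d$ be a box centred at the origin, with volume $|\Lambda|\in(0,\infty)$. The reference measure $\mathsf{Q}_\Lambda$ is the probability measure on families $(N_k)_{k\in\mathbb{N}}$ of cycle counts $N_k\in\{0,1,2,\dots\}$ with finitely many nonzero entries given by $$\mathsf{Q}_\Lambda\big((N_k)_{k}\big)=e^{-|\Lambda|\overline q^{(\alpha)}}\prod_{k\ge1}\frac{(|\Lambda| q_k e^{\beta\alpha k})^{N_k}}{N_k!}.$$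 Write $\mathbb{E}_\Lambda$ for its expectation and $\lambda_k=N_k/|\Lambda|$. For a cut-off $m_\Lambda\in\{0,1,2,\dots\}$ the Hamiltonian is $$H_\Lambda=|\Lambda|\Big(-(\mu-\alpha)\sum_{k\ge1}k\lambda_k+\frac a2\Big(\sum_{k\ge1}k\lambda_k\Big)^2-\frac b2\sum_{k\ge m_\Lambda}k^2\lambda_k^2\Big),$$ the Gibbs measure is $d\mathsf{P}_\Lambda/d\mathsf{Q}_\Lambda=e^{-\beta H_\Lambda}/\mathbb{E}_\Lambda[e^{-\beta H_\Lambda}]$, the partition function is $Z_\Lambda=e^{|\Lambda|\overline q^{(\alpha)}}\,\mathbb{E}_\Lambda[e^{-\beta H_\Lambda}]$, and the pair empirical particle density is $$\mathbf{M}_\Lambda=\Big(\sum_{1\le k<m_\Lambda}k\lambda_k,\ \sum_{k\ge m_\Lambda}k\lambda_k\Big)\in\mathbb{R}_+^2 ,\qquad \mathbb{R}_+=[0,\infty).$$ \emph{Claim.} Let $(\Lambda_n)_{n}$ be a sequence of centred boxes in $\mathbb{R}^d$ with $|\Lambda_n|\to\infty$, and let $m_{\Lambda_n}$ be cut-offs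 with $m_{\Lambda_n}\to\infty$ and $m_{\Lambda_n}/|\Lambda_n|\to\kappa\in[0,\infty]$. Put $\mathbb{K}(\kappa)=\mathbb{R}_+\times(\{0\}\cup[\kappa,\infty))$, so that $\mathbb{K}(\infty)=\mathbb{R}_+\times\{0\}$. Then $\mathsf{Q}_{\Lambda_n}$ and the law $\mathsf{P}_{\Lambda_n}\circ\mathbf{M}_{\Lambda_n}^{-1}$ are probability measures for every $n$, and: (1) the thermodynamic pressure $p^{(\kappa)}(\beta,\alpha,\mu)=\lim_{n\to\infty}\frac{1}{\beta|\Lambda_n|}\log Z_{\Lambda_n}$ exists in $\mathbb{R}$ and $$p^{(\kappa)}(\beta,\alpha,\mu)=\sup_{(x,y)\in\mathbb{K}(\kappa)}\Big\{\mu(x+y)-\frac a2(x+y)^2+\frac b2y^2-f_0(\beta,x)\Big\};$$ (2) the sequence $(\mathsf{P}_{\Lambda_n}\circ\mathbf{M}_{\Lambda_n}^{-1})_n$ satisfies the large deviation principle on $\mathbb{R}_+^2$ with rate (speed) $\beta|\Lambda_n|$ and good rate function (nonnegative, lower semicontinuous, with compact level sets) $$I^{(\kappa)}(x,y)=\begin{cases}f_0(\beta,x)-\mu(x+y)+\frac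 a2(x+y)^2-\frac b2y^2+p^{(\kappa)}(\beta,\alpha,\mu)&\text{if }(x,y)\in\mathbb{K}(\kappa),\\+\infty&\text{otherwise.}\end{cases}$$ -/

import Mathlib

open MeasureTheory Filter Topology
open scoped NNReal ENNReal

noncomputable section

namespace HYL

/-! ### Large deviation principles -/

/-- A good rate function: nonnegative, lower semicontinuous, with compact level sets. -/
structure IsGoodRateFunction {X : Type*} [TopologicalSpace X] (I : X → EReal) : Prop where
  nonneg : ∀ x, 0 ≤ I x
  lowerSemicontinuous : LowerSemicontinuous I
  isCompact_sublevel : ∀ c : ℝ, IsCompact {x | I x ≤ (c : EReal)}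

/-- The sequence of measures `P n` satisfies the large deviation principle with rate (speed) `s n`
and rate function `I`. Here `ENNReal.log 0 = -∞`. -/
structure SatisfiesLDP {X : Type*} [TopologicalSpace X] [MeasurableSpace X]
    (P : ℕ → Measure X) (s : ℕ → ℝ) (I : X → EReal) : Prop where
  upper : ∀ C : Set X, IsClosed C →
    limsup (fun n => (((s n)⁻¹ : ℝ) : EReal) * ENNReal.log (P n C)) atTop ≤ -(⨅ x ∈ C, I x)
  lower : ∀ O : Set X, IsOpen O →
    -(⨅ x ∈ O, I x) ≤ liminf (fun n => (((s n)⁻¹ : ℝ) : EReal) * ENNReal.log (P n O)) atTop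

/-! ### The ideal Bose gas -/

/-- The weight `q_k = 1 / ((4πβ)^{d/2} k^{1+d/2})`. -/
def q (d : ℕ) (β : ℝ) (k : ℕ+) : ℝ :=
  1 / ((4 * Real.pi * β) ^ ((d : ℝ) / 2) * (k : ℝ) ^ (1 + (d : ℝ) / 2))

/-- The sum `∑_k q_k e^{βαk}`, in `[0, ∞]` (it is infinite for `α > 0`). -/
def qbar (d : ℕ) (β α : ℝ) : ℝ≥0∞ :=
  ∑' k : ℕ+, ENNReal.ofReal (q d β k * Real.exp (β * α * k))

/-- The pressure `p₀(β, α) = q̄^{(α)} / β` of the ideal Bose gas, in `[0, ∞]`. -/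
def p₀ (d : ℕ) (β α : ℝ) : ℝ≥0∞ := qbar d β α / ENNReal.ofReal β

/-- The free energy of the ideal Bose gas, the Legendre-Fenchel transform
`f₀(β, x) = sup_{α ∈ ℝ} (α x - p₀(β, α))`. -/
def f₀ (d : ℕ) (β x : ℝ) : EReal :=
  ⨆ α : ℝ, (((α * x : ℝ) : EReal) - ((p₀ d β α : ℝ≥0∞) : EReal))

/-! ### Cycle counts and the reference process -/

/-- `Λ` is a (closed, nondegenerate) box in `ℝ^d` centred at the origin. -/
def IsCentredBox {d : ℕ} (Λ : Set (EuclideanSpace ℝ (Fin d))) : Prop :=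
  ∃ L : Fin d → ℝ, (∀ j, 0 < L j) ∧ Λ = {x | ∀ j, |x j| ≤ L j / 2}

/-- Configurations of cycle counts: `N k` is the number of cycles of length `k`. The total number
of particles is finite, so all but finitely many counts vanish. -/
abbrev CycleCounts : Type := ℕ+ →₀ ℕ

instance : MeasurableSpace CycleCounts := ⊤

instance : DiscreteMeasurableSpace CycleCounts := ⟨fun _ => trivial⟩

variable {d : ℕ}

/-- The probability of the configuration `N` under the reference process in `Λ`, i.e.
`e^{-|Λ| q̄} ∏_k (|Λ| q_k e^{βαk})^{N_k} / N_k!`. -/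
def refWeight (β α : ℝ) (Λ : Set (EuclideanSpace ℝ (Fin d))) (N : CycleCounts) : ℝ :=
  Real.exp (-(volume.real Λ * (qbar d β α).toReal)) *
    N.prod fun k j => (volume.real Λ * (q d β k * Real.exp (β * α * k))) ^ j / (j.factorial : ℝ)

/-- The reference measure `Q_Λ`, as the law of the cycle counts. -/
def refMeasure (β α : ℝ) (Λ : Set (EuclideanSpace ℝ (Fin d))) : Measure CycleCounts :=
  Measure.sum fun N => ENNReal.ofReal (refWeight β α Λ N) • Measure.dirac N

/-- The bosonic cycle count density `λ_k = N_k / |Λ|`. -/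
def cycleDensity (Λ : Set (EuclideanSpace ℝ (Fin d))) (N : CycleCounts) (k : ℕ+) : ℝ≥0 :=
  (N k : ℝ≥0) / (volume Λ).toNNReal

/-! ### The spatial cycle HYL model -/

/-- The Hamiltonian of the spatial cycle HYL model in `Λ` with cut-off `m`. -/
def hamiltonian (α μ a b : ℝ) (Λ : Set (EuclideanSpace ℝ (Fin d))) (m : ℕ)
    (N : CycleCounts) : ℝ :=
  volume.real Λ *
    (-(μ - α) * (∑ k ∈ N.support, (k : ℝ) * cycleDensity Λ N k)
      + a / 2 * (∑ k ∈ N.support, (k : ℝ) * cycleDensity Λ N k) ^ 2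
      - b / 2 * ∑ k ∈ N.support.filter (fun k : ℕ+ => m ≤ (k : ℕ)), (k : ℝ) ^ 2 * (cycleDensity Λ N k : ℝ) ^ 2)

/-- The Gibbs distribution `dP_Λ / dQ_Λ = e^{-βH_Λ} / E[e^{-βH_Λ}]`. -/
def gibbs (β α μ a b : ℝ) (Λ : Set (EuclideanSpace ℝ (Fin d))) (m : ℕ) : Measure CycleCounts :=
  (refMeasure β α Λ).tilted fun N => -β * hamiltonian α μ a b Λ m N

/-- The partition function `Z_Λ = e^{|Λ| q̄} E[e^{-βH_Λ}]`. -/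
def partitionFunction (β α μ a b : ℝ) (Λ : Set (EuclideanSpace ℝ (Fin d))) (m : ℕ) : ℝ :=
  Real.exp (volume.real Λ * (qbar d β α).toReal) *
    ∫ N, Real.exp (-β * hamiltonian α μ a b Λ m N) ∂(refMeasure β α Λ)

/-- The pair empirical particle density
`M_Λ = (∑_{k < m} k λ_k, ∑_{k ≥ m} k λ_k)`, with values in `ℝ²₊`. -/
def pairDensity (Λ : Set (EuclideanSpace ℝ (Fin d))) (m : ℕ) (N : CycleCounts) : ℝ≥0 × ℝ≥0 :=
  (∑ k ∈ N.support.filter (fun k : ℕ+ => (k : ℕ) < m), (k : ℝ≥0) * cycleDensity Λ N k,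
   ∑ k ∈ N.support.filter (fun k : ℕ+ => m ≤ (k : ℕ)), (k : ℝ≥0) * cycleDensity Λ N k)

/-- The law of the pair empirical particle density under the Gibbs distribution. -/
def pairLaw (β α μ a b : ℝ) (Λ : Set (EuclideanSpace ℝ (Fin d))) (m : ℕ) :
    Measure (ℝ≥0 × ℝ≥0) :=
  (gibbs β α μ a b Λ m).map (pairDensity Λ m)

/-- The set `K(κ) = ℝ₊ × ({0} ∪ [κ, ∞))`; for `κ = ∞` it is `ℝ₊ × {0}`. -/
def K (κ : ℝ≥0∞) : Set (ℝ≥0 × ℝ≥0) := {z | z.2 = 0 ∨ κ ≤ (z.2 : ℝ≥0∞)}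

open scoped Classical in
/-- The rate function `I^{(κ)}`, where `p` is the value of the pressure. -/
def rateFunction (d : ℕ) (β μ a b : ℝ) (κ : ℝ≥0∞) (p : ℝ) (z : ℝ≥0 × ℝ≥0) : EReal :=
  if z ∈ K κ then
    f₀ d β z.1 + ((-μ * (z.1 + z.2) + a / 2 * (z.1 + z.2) ^ 2 - b / 2 * z.2 ^ 2 + p : ℝ) : EReal)
  else ⊤

end HYL

end

namespace HYL

/-! ### Summing cycle weights -/

/-! The factor `e^{βαk}` in the reference measure cancels the `α` in the Hamiltonian, so a
configuration contributes `∏ (|Λ| q_k)^{N_k} / N_k!` times the exponential of `β|Λ|(μ(X+Y) - a/2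
(X+Y)² + b/2 Q)`. Here `(X, Y)` are the short- and long-cycle densities and `Q` is the sum of the
squared densities of the individual long cycle lengths. Both conclusions follow once the measure
`unnormalizedLaw` with these weights has the local exponential rate `pressureFunctional` on `K κ`,
since its total mass is the partition function.

Upper bound: `Q ≤ Y²`, with equality when the long-cycle mass sits on one length. Tilting only the
short cycles by `s ≤ 0` and summing the Poisson weights exactly gives `unnormalizedLaw_le`; a nearly
optimal `s` turns the bound near `z` into `pressureFunctional`, because `f₀` is a supremum over `s ≤
0`. The long cycles keep the vanishing weight `qTail`. A nonempty set of long cycles has density at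
least `m/|Λ|`, which excludes points outside `K κ`. Compactness and `a > b` pass from small
neighbourhoods to closed sets (`eventually_unnormalizedLaw_le`).

Lower bound: one configuration suffices (`eventually_le_unnormalizedLaw`). Its short cycles follow a
Poissonian profile truncated at a fixed length (`exists_truncated_profile`), whose cost is found by
Stirling. If `Y > 0`, one giant cycle of length about `Y|Λ|` carries the long density: it makes `Q`
close to `Y²` and costs only a power of the volume. -/

/-- The Poisson-type weight `∏_k x_k^{N_k} / N_k!` of a configuration of cycle counts. -/
noncomputable def cycleWeight (x : ℕ+ → ℝ) (N : CycleCounts) : ℝ :=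
  N.prod fun k j => x k ^ j / (j.factorial : ℝ)

lemma cycleWeight_nonneg {x : ℕ+ → ℝ} (hx : ∀ k, 0 ≤ x k) (N : CycleCounts) :
    0 ≤ cycleWeight x N :=
  Finset.prod_nonneg fun k _ => by have := hx k; positivity

/-- Since `g k 0 = 1`, a product over the support may be taken over all of `S`, and the sum then
factorises over the coordinates. -/
lemma sum_finsupp_prod {ι : Type*} (S : Finset ι) (t : ι → Finset ℕ) (g : ι → ℕ → ℝ)
    (hg : ∀ k, g k 0 = 1) :
    ∑ N ∈ S.finsupp t, N.prod g = ∏ k ∈ S, ∑ j ∈ t k, g k j := by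
  classical
  rw [Finset.prod_sum, Finset.finsupp, Finset.sum_map]
  refine Finset.sum_congr rfl fun p _ => ?_
  simp only [Function.Embedding.coeFn_mk]
  rw [Finsupp.prod_indicator_index_eq_prod_attach]
  intro i _; exact hg i

lemma sum_pow_div_factorial_le_exp {x : ℝ} (hx : 0 ≤ x) (n : ℕ) :
    ∑ j ∈ Finset.range n, x ^ j / (j.factorial : ℝ) ≤ Real.exp x :=
  Real.sum_le_exp_of_nonneg hx n

theorem hasSum_cycleWeight {x : ℕ+ → ℝ} (hx : ∀ k, 0 ≤ x k) (hs : Summable x) :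
    HasSum (cycleWeight x) (Real.exp (∑' k, x k)) := by
  classical
  have key : ∀ (S : Finset ℕ+) (n : ℕ),
      ∑ N ∈ S.finsupp (fun _ => Finset.range n), cycleWeight x N
        = ∏ k ∈ S, ∑ j ∈ Finset.range n, x k ^ j / (j.factorial : ℝ) := fun S n =>
    sum_finsupp_prod S _ (fun k j => x k ^ j / (j.factorial : ℝ)) (by simp)
  refine hasSum_of_isLUB_of_nonneg _ (cycleWeight_nonneg hx) ⟨?_, ?_⟩
  · rintro _ ⟨F, rfl⟩
    set S : Finset ℕ+ := F.biUnion fun N => N.support with hS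
    -- The box of configurations supported in `S` with entries below `n` contains `F`; the `+ 1` is
    -- there because `Finset.range n` excludes `n`.
    set n : ℕ := (F.sup fun N => N.support.sup fun k => N k) + 1 with hn
    have hsub : F ⊆ S.finsupp (fun _ => Finset.range n) := by
      intro N hN
      rw [Finset.mem_finsupp_iff]
      refine ⟨Finset.subset_biUnion_of_mem (fun N : CycleCounts => N.support) hN, fun k _ => ?_⟩
      rw [Finset.mem_range, hn, Nat.lt_succ_iff]
      by_cases hk : k ∈ N.support
      · exact (Finset.le_sup (f := fun k => N k) hk).trans
          (Finset.le_sup (f := fun N : CycleCounts => N.support.sup fun k => N k) hN)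
      · simp [Finsupp.notMem_support_iff.1 hk]
    calc ∑ N ∈ F, cycleWeight x N
        ≤ ∑ N ∈ S.finsupp (fun _ => Finset.range n), cycleWeight x N :=
          Finset.sum_le_sum_of_subset_of_nonneg hsub fun N _ _ => cycleWeight_nonneg hx N
      _ = ∏ k ∈ S, ∑ j ∈ Finset.range n, x k ^ j / (j.factorial : ℝ) := key S n
      _ ≤ ∏ k ∈ S, Real.exp (x k) :=
          Finset.prod_le_prod
            (fun k _ => Finset.sum_nonneg fun j _ => by have := hx k; positivity)
            fun k _ => sum_pow_div_factorial_le_exp (hx k) n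
      _ = Real.exp (∑ k ∈ S, x k) := (Real.exp_sum _ _).symm
      _ ≤ _ := Real.exp_le_exp.2 (hs.sum_le_tsum S fun k _ => hx k)
  · intro u hu
    -- For fixed `S` the cap on the counts goes to infinity first; `S` exhausts `ℕ+` only
    -- afterwards.
    have h1 : ∀ S : Finset ℕ+, Real.exp (∑ k ∈ S, x k) ≤ u := by
      intro S
      rw [Real.exp_sum]
      refine le_of_tendsto' (tendsto_finsetProd (a := fun k => Real.exp (x k)) S
        (f := fun k n => ∑ j ∈ Finset.range n, x k ^ j / (j.factorial : ℝ)) (x := atTop)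
        fun k _ => ?_) fun n => ?_
      · have := (NormedSpace.expSeries_div_hasSum_exp (x k)).tendsto_sum_nat
        rwa [← Real.exp_eq_exp_ℝ] at this
      · rw [← key S n]; exact hu ⟨_, rfl⟩
    exact le_of_tendsto' ((Real.continuous_exp.tendsto _).comp hs.hasSum) h1

lemma tsum_ofReal_cycleWeight {x : ℕ+ → ℝ} (hx : ∀ k, 0 ≤ x k) (hs : Summable x) :
    ∑' N, ENNReal.ofReal (cycleWeight x N) = ENNReal.ofReal (Real.exp (∑' k, x k)) := by
  rw [← (hasSum_cycleWeight hx hs).tsum_eq,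
    ENNReal.ofReal_tsum_of_nonneg (cycleWeight_nonneg hx) (hasSum_cycleWeight hx hs).summable]

end HYL

namespace HYL

/-! ### The ideal Bose gas -/

section IdealGas

variable {d : ℕ} {β : ℝ}

lemma q_pos (hβ : 0 < β) (k : ℕ+) : 0 < q d β k := by
  have hk : (0 : ℝ) < (k : ℕ) := by exact_mod_cast k.pos
  unfold q; positivity

lemma summable_q (hd : 1 ≤ d) : Summable (q d β) := by
  have h1 : (1 : ℝ) < 1 + (d : ℝ) / 2 := by
    have : (1 : ℝ) ≤ d := by exact_mod_cast hd
    linarith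
  have h2 := ((Real.summable_one_div_nat_rpow.2 h1).comp_injective
    (i := fun k : ℕ+ => (k : ℕ)) PNat.coe_injective).mul_left (1 / (4 * Real.pi * β) ^ ((d : ℝ) / 2))
  refine h2.congr fun k => ?_
  simp only [Function.comp, q]
  rw [one_div_mul_one_div]

lemma q_mul_exp_le (hβ : 0 < β) {s : ℝ} (hs : s ≤ 0) (k : ℕ+) :
    q d β k * Real.exp (β * s * k) ≤ q d β k := by
  refine mul_le_of_le_one_right (q_pos hβ k).le (Real.exp_le_one_iff.2 ?_)
  have : β * s ≤ 0 := mul_nonpos_of_nonneg_of_nonpos hβ.le hs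
  exact mul_nonpos_of_nonpos_of_nonneg this (by positivity)

lemma q_mul_exp_nonneg (hβ : 0 < β) (s : ℝ) (k : ℕ+) : 0 ≤ q d β k * Real.exp (β * s * k) :=
  mul_nonneg (q_pos hβ k).le (Real.exp_nonneg _)

lemma summable_q_mul_exp (hd : 1 ≤ d) (hβ : 0 < β) {s : ℝ} (hs : s ≤ 0) :
    Summable fun k : ℕ+ => q d β k * Real.exp (β * s * k) :=
  Summable.of_nonneg_of_le (q_mul_exp_nonneg hβ s) (q_mul_exp_le hβ hs) (summable_q hd)

/-- An exponential beats the polynomial decay of `q`. This makes the ideal pressure infinite for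
positive `s`, and in `exists_truncated_profile` it lets a single long enough cycle length supply any
density at a tiny positive `s`. -/
lemma tendsto_q_mul_exp_atTop (hβ : 0 < β) {c : ℝ} (hc : 0 < c) :
    Tendsto (fun n : ℕ => q d β n.succPNat * Real.exp (c * (n.succPNat : ℕ))) atTop atTop := by
  have h1 := (tendsto_exp_mul_div_rpow_atTop (1 + (d : ℝ) / 2) c hc).comp
    (tendsto_natCast_atTop_atTop.comp (tendsto_add_atTop_nat 1))
  have h2 := h1.const_mul_atTop
    (show (0 : ℝ) < 1 / (4 * Real.pi * β) ^ ((d : ℝ) / 2) by positivity)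
  refine h2.congr fun n => ?_
  simp only [Function.comp, q, Nat.succPNat_coe, Nat.succ_eq_add_one]
  rw [one_div, one_div, mul_inv]
  ring

lemma qbar_eq_top (hβ : 0 < β) {s : ℝ} (hs : 0 < s) : qbar d β s = ⊤ := by
  refine ENNReal.eq_top_of_forall_nnreal_le fun r => ?_
  obtain ⟨n, hn⟩ := ((tendsto_q_mul_exp_atTop (d := d) hβ (mul_pos hβ hs)).eventually_ge_atTop
    (r : ℝ)).exists
  refine le_trans ?_ (ENNReal.le_tsum n.succPNat)
  rw [← ENNReal.ofReal_coe_nnreal]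
  exact ENNReal.ofReal_le_ofReal hn

lemma qbar_eq_ofReal (hd : 1 ≤ d) (hβ : 0 < β) {s : ℝ} (hs : s ≤ 0) :
    qbar d β s = ENNReal.ofReal (∑' k : ℕ+, q d β k * Real.exp (β * s * k)) :=
  (ENNReal.ofReal_tsum_of_nonneg (q_mul_exp_nonneg hβ s) (summable_q_mul_exp hd hβ hs)).symm

variable (d β) in
/-- The pressure of the ideal Bose gas as a real number; meaningful for `s ≤ 0`. -/
noncomputable def idealPressure (s : ℝ) : ℝ :=
  (∑' k : ℕ+, q d β k * Real.exp (β * s * k)) / β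

lemma mul_idealPressure (hβ : 0 < β) (s : ℝ) :
    β * idealPressure d β s = ∑' k : ℕ+, q d β k * Real.exp (β * s * k) := by
  unfold idealPressure; field_simp

lemma idealPressure_nonneg (hβ : 0 < β) (s : ℝ) : 0 ≤ idealPressure d β s :=
  div_nonneg (tsum_nonneg (q_mul_exp_nonneg hβ s)) hβ.le

lemma p₀_eq_ofReal (hd : 1 ≤ d) (hβ : 0 < β) {s : ℝ} (hs : s ≤ 0) :
    p₀ d β s = ENNReal.ofReal (idealPressure d β s) := by
  rw [p₀, qbar_eq_ofReal hd hβ hs, idealPressure, ENNReal.ofReal_div_of_pos hβ]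

variable (d β) in
/-- The free energy of the ideal Bose gas as a real number. -/
noncomputable def freeEnergy (x : ℝ) : ℝ :=
  sSup ((fun s => s * x - idealPressure d β s) '' Set.Iic 0)

lemma bddAbove_freeEnergy (hβ : 0 < β) {x : ℝ} (hx : 0 ≤ x) :
    BddAbove ((fun s => s * x - idealPressure d β s) '' Set.Iic 0) := by
  refine ⟨0, ?_⟩
  rintro _ ⟨s, hs, rfl⟩
  have := mul_nonpos_of_nonpos_of_nonneg (Set.mem_Iic.1 hs) hx
  have := idealPressure_nonneg (d := d) hβ s
  simp only; linarith

lemma le_freeEnergy (hβ : 0 < β) {x : ℝ} (hx : 0 ≤ x) {s : ℝ} (hs : s ≤ 0) :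
    s * x - idealPressure d β s ≤ freeEnergy d β x :=
  le_csSup (bddAbove_freeEnergy hβ hx) ⟨s, hs, rfl⟩

lemma exists_lt_of_lt_freeEnergy {x c : ℝ} (hc : c < freeEnergy d β x) :
    ∃ s ≤ 0, c < s * x - idealPressure d β s := by
  obtain ⟨_, ⟨s, hs, rfl⟩, h⟩ := exists_lt_of_lt_csSup (Set.nonempty_Iic.image _) hc
  exact ⟨s, hs, h⟩

lemma freeEnergy_le {x c : ℝ} (h : ∀ s ≤ 0, s * x - idealPressure d β s ≤ c) :
    freeEnergy d β x ≤ c := by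
  refine csSup_le (Set.nonempty_Iic.image _) ?_
  rintro _ ⟨s, hs, rfl⟩
  exact h s hs

lemma neg_idealPressure_zero_le_freeEnergy (hβ : 0 < β) {x : ℝ} (hx : 0 ≤ x) :
    -idealPressure d β 0 ≤ freeEnergy d β x := by
  simpa using le_freeEnergy (d := d) hβ hx le_rfl

/-- Only slopes `s ≤ 0` enter the supremum. The lower bound uses this to raise the short-cycle
density at no entropic cost. -/
lemma freeEnergy_antitone (hβ : 0 < β) {x y : ℝ} (hx : 0 ≤ x) (hxy : x ≤ y) :
    freeEnergy d β y ≤ freeEnergy d β x :=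
  freeEnergy_le fun _ hs => le_trans
    (sub_le_sub_right (mul_le_mul_of_nonpos_left hxy hs) _) (le_freeEnergy hβ hx hs)

/-- For `s > 0` the pressure is infinite, so such `s` contribute `-∞` to the supremum. -/
lemma f₀_eq_freeEnergy (hd : 1 ≤ d) (hβ : 0 < β) {x : ℝ} (hx : 0 ≤ x) :
    f₀ d β x = (freeEnergy d β x : EReal) := by
  have hterm : ∀ s ≤ 0, ((s * x : ℝ) : EReal) - ((p₀ d β s : ℝ≥0∞) : EReal)
      = ((s * x - idealPressure d β s : ℝ) : EReal) := by
    intro s hs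
    rw [p₀_eq_ofReal hd hβ hs, EReal.coe_ennreal_ofReal,
      max_eq_left (idealPressure_nonneg hβ s), EReal.coe_sub]
  refine le_antisymm (iSup_le fun s => ?_) (le_of_forall_lt fun c hc => ?_)
  · rcases le_or_gt s 0 with hs | hs
    · rw [hterm s hs]
      exact_mod_cast le_freeEnergy hβ hx hs
    · rw [p₀, qbar_eq_top hβ hs, ENNReal.top_div_of_ne_top ENNReal.ofReal_ne_top]
      simp
  · induction c with
    | bot =>
      refine lt_of_lt_of_le (EReal.bot_lt_coe _) ((hterm 0 le_rfl).symm.le.trans ?_)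
      exact le_iSup (fun s : ℝ => ((s * x : ℝ) : EReal) - ((p₀ d β s : ℝ≥0∞) : EReal)) 0
    | coe r =>
      obtain ⟨s, hs, h⟩ := exists_lt_of_lt_freeEnergy (EReal.coe_lt_coe_iff.1 hc)
      refine lt_of_lt_of_le ((EReal.coe_lt_coe_iff.2 h).trans_eq (hterm s hs).symm) ?_
      exact le_iSup (fun s : ℝ => ((s * x : ℝ) : EReal) - ((p₀ d β s : ℝ≥0∞) : EReal)) s
    | top => exact absurd hc not_top_lt

/-- Restricting to cycles of length at most `L`, the density `x` is realised by a Poissonian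
profile whose entropy is nearly optimal. -/
lemma exists_truncated_profile (hd : 1 ≤ d) (hβ : 0 < β) {x ε : ℝ} (hx : 0 < x) (hε : 0 < ε) :
    ∃ (L : ℕ+) (s : ℝ),
      ∑ k ∈ Finset.Icc 1 L, (k : ℝ) * (q d β k * Real.exp (β * s * k)) = x ∧
      -(β * freeEnergy d β x) - ε
        ≤ ∑ k ∈ Finset.Icc 1 L, q d β k * Real.exp (β * s * k) - β * s * x := by
  have hq := summable_q (β := β) hd
  have htail : Tendsto (fun n : ℕ => ∑ k ∈ Finset.Icc 1 n.succPNat, q d β k) atTop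
      (𝓝 (∑' k, q d β k)) := by
    refine hq.hasSum.comp (tendsto_atTop_finset_of_monotone ?_ ?_)
    · intro i j hij
      exact Finset.Icc_subset_Icc_right (Nat.succPNat_mono hij)
    · intro k
      refine ⟨k.natPred, ?_⟩
      simp
  -- Two demands on the truncation: the discarded tail of `q` is below `ε / 2`, and at `βs = ε /
  -- (2x)` cycles of length `L` alone already exceed density `x`. The second forces the solution `s`
  -- to satisfy `βsx < ε / 2`.
  obtain ⟨n, hn1, hn2⟩ := ((htail.eventually_const_lt
      (show (∑' k, q d β k) - ε / 2 < ∑' k, q d β k by linarith)).and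
    ((tendsto_q_mul_exp_atTop (d := d) hβ
      (show 0 < ε / (2 * x) by positivity)).eventually_gt_atTop x)).exists
  set L := n.succPNat
  set g : ℝ → ℝ := fun s =>
    ∑ k ∈ Finset.Icc 1 L, (k : ℝ) * (q d β k * Real.exp (β * s * k)) with hg
  have hgc : Continuous g := by fun_prop
  have hterm : ∀ s, (L : ℝ) * (q d β L * Real.exp (β * s * L)) ≤ g s := fun s =>
    Finset.single_le_sum (f := fun k : ℕ+ => (k : ℝ) * (q d β k * Real.exp (β * s * k)))
      (fun k _ => mul_nonneg (by positivity) (q_mul_exp_nonneg hβ s k)) (by simp)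
  have hL1 : (1 : ℝ) ≤ (L : ℕ) := Nat.one_le_cast.2 L.pos
  have hbot : Tendsto g atBot (𝓝 0) := by
    have : Tendsto g atBot (𝓝 (∑ k ∈ Finset.Icc 1 L, (k : ℝ) * (q d β k * 0))) := by
      refine tendsto_finsetSum _ fun k _ => ((Tendsto.const_mul _ ?_).const_mul _)
      refine Real.tendsto_exp_atBot.comp ?_
      have hk : (0 : ℝ) < (k : ℕ) := by exact_mod_cast k.pos
      exact (tendsto_id.const_mul_atBot hβ).atBot_mul_const hk
    simpa using this
  have hbound : ∀ s, x ≥ g s → β * s < ε / (2 * x) := by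
    intro s hs
    by_contra! h
    have h1 : q d β L * Real.exp (ε / (2 * x) * L) ≤ q d β L * Real.exp (β * s * L) := by
      have := (q_pos (d := d) hβ L).le
      gcongr
    have h2 : q d β L * Real.exp (β * s * L) ≤ (L : ℝ) * (q d β L * Real.exp (β * s * L)) :=
      le_mul_of_one_le_left (q_mul_exp_nonneg hβ s L) hL1
    have h3 := hterm s
    exact absurd hn2 (not_lt.2 (h1.trans (h2.trans (h3.trans hs))))
  obtain ⟨s₁, hs₁⟩ := (hbot.eventually_lt_const hx).exists
  have hs₂ : x ≤ g (ε / (2 * x) / β) := by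
    by_contra! h
    have := hbound _ h.le
    rw [mul_div_cancel₀ _ hβ.ne'] at this
    exact lt_irrefl _ this
  -- Intermediate values: the truncated density tends to `0` as `s → -∞` and is at least `x` at `βs
  -- = ε / (2x)`.
  obtain ⟨s, hs⟩ := mem_range_of_exists_le_of_exists_ge hgc ⟨s₁, hs₁.le⟩ ⟨_, hs₂⟩
  refine ⟨L, s, hs, ?_⟩
  -- For `s ≤ 0` this `s` is a competitor in `freeEnergy`, and truncation loses at most the tail of
  -- `q`. For `s > 0` the comparison is with the competitor `0`, and both the tail and `βsx` cost
  -- less than `ε / 2`.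
  rcases le_or_gt s 0 with h0 | h0
  · have h1 := le_freeEnergy (d := d) hβ hx.le h0
    have h2 : ∑ k ∈ Finset.Icc 1 L, (q d β k - q d β k * Real.exp (β * s * k))
        ≤ ∑' k : ℕ+, (q d β k - q d β k * Real.exp (β * s * k)) :=
      (hq.sub (summable_q_mul_exp hd hβ h0)).sum_le_tsum _
        fun k _ => sub_nonneg.2 (q_mul_exp_le hβ h0 k)
    rw [hq.tsum_sub (summable_q_mul_exp hd hβ h0), Finset.sum_sub_distrib,
      ← mul_idealPressure hβ] at h2
    nlinarith
  · have h1 := neg_idealPressure_zero_le_freeEnergy (d := d) hβ hx.le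
    have h2 : β * idealPressure d β 0 = ∑' k, q d β k := by
      rw [mul_idealPressure hβ]; simp
    have h3 : ∑ k ∈ Finset.Icc 1 L, q d β k
        ≤ ∑ k ∈ Finset.Icc 1 L, q d β k * Real.exp (β * s * k) :=
      Finset.sum_le_sum fun k _ => le_mul_of_one_le_right (q_pos hβ k).le
        (Real.one_le_exp (by positivity))
    have h4 : β * s * x < ε / (2 * x) * x := mul_lt_mul_of_pos_right (hbound s hs.le) hx
    have h5 : ε / (2 * x) * x = ε / 2 := by field_simp
    nlinarith

end IdealGas

end HYL

namespace HYL

/-! ### Weights of configurations -/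

/-- The tilting identity, used to cancel `α` in `gibbsWeight_eq` and to carry out the Chernoff bound
in `unnormalizedLaw_le`. -/
lemma cycleWeight_mul_exp (x c : ℕ+ → ℝ) (N : CycleCounts) :
    cycleWeight (fun k => x k * Real.exp (c k)) N
      = cycleWeight x N * Real.exp (N.sum fun k j => c k * j) := by
  unfold cycleWeight Finsupp.sum Finsupp.prod
  rw [Real.exp_sum, ← Finset.prod_mul_distrib]
  refine Finset.prod_congr rfl fun k _ => ?_
  dsimp only
  rw [mul_pow, ← Real.exp_nat_mul, mul_comm (c k)]
  ring

variable {d : ℕ} {β α μ a b : ℝ} {Λ : Set (EuclideanSpace ℝ (Fin d))} {m : ℕ}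

lemma coe_cycleDensity (Λ : Set (EuclideanSpace ℝ (Fin d))) (N : CycleCounts) (k : ℕ+) :
    (cycleDensity Λ N k : ℝ) = N k / volume.real Λ := by
  simp [cycleDensity, Measure.real, ENNReal.coe_toNNReal_eq_toReal]

lemma coe_pairDensity_fst (Λ : Set (EuclideanSpace ℝ (Fin d))) (m : ℕ) (N : CycleCounts) :
    ((pairDensity Λ m N).1 : ℝ)
      = N.sum fun k j => if (k : ℕ) < m then (k : ℝ) * (j / volume.real Λ) else 0 := by
  simp [pairDensity, Finsupp.sum, Finset.sum_filter, coe_cycleDensity, apply_ite]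

lemma coe_pairDensity_snd (Λ : Set (EuclideanSpace ℝ (Fin d))) (m : ℕ) (N : CycleCounts) :
    ((pairDensity Λ m N).2 : ℝ)
      = N.sum fun k j => if m ≤ (k : ℕ) then (k : ℝ) * (j / volume.real Λ) else 0 := by
  simp [pairDensity, Finsupp.sum, Finset.sum_filter, coe_cycleDensity, apply_ite]

/-- The sum of the squared particle densities of the cycles of length at least `m`. -/
noncomputable def longCycleSquares (Λ : Set (EuclideanSpace ℝ (Fin d))) (m : ℕ)
    (N : CycleCounts) : ℝ :=
  N.sum fun k j => if m ≤ (k : ℕ) then ((k : ℝ) * (j / volume.real Λ)) ^ 2 else 0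

lemma longCycleSquares_le (Λ : Set (EuclideanSpace ℝ (Fin d))) (m : ℕ) (N : CycleCounts) :
    longCycleSquares Λ m N ≤ ((pairDensity Λ m N).2 : ℝ) ^ 2 := by
  rw [coe_pairDensity_snd, longCycleSquares, Finsupp.sum, Finsupp.sum, ← Finset.sum_filter,
    ← Finset.sum_filter]
  exact Finset.sum_sq_le_sq_sum_of_nonneg fun k _ => by positivity

lemma sum_cycleDensity (Λ : Set (EuclideanSpace ℝ (Fin d))) (m : ℕ) (N : CycleCounts) :
    ∑ k ∈ N.support, (k : ℝ) * cycleDensity Λ N k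
      = (pairDensity Λ m N).1 + (pairDensity Λ m N).2 := by
  rw [coe_pairDensity_fst, coe_pairDensity_snd, ← Finsupp.sum_add]
  refine Finset.sum_congr rfl fun k _ => ?_
  rw [coe_cycleDensity]
  rcases lt_or_ge (k : ℕ) m with h | h
  · simp [h, not_le.2 h]
  · simp [h, not_lt.2 h]

lemma hamiltonian_eq (α μ a b : ℝ) (Λ : Set (EuclideanSpace ℝ (Fin d))) (m : ℕ)
    (N : CycleCounts) :
    hamiltonian α μ a b Λ m N = volume.real Λ *
      (-(μ - α) * ((pairDensity Λ m N).1 + (pairDensity Λ m N).2)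
        + a / 2 * ((pairDensity Λ m N).1 + (pairDensity Λ m N).2) ^ 2
        - b / 2 * longCycleSquares Λ m N) := by
  rw [hamiltonian, sum_cycleDensity Λ m N, longCycleSquares, Finsupp.sum, Finset.sum_filter]
  simp only [coe_cycleDensity, mul_pow]

/-- The squares are at most `Y² ≤ (X + Y)²`, so what remains is a quadratic in `X + Y` with leading
coefficient `-(a - b)/2`; completing the square gives the constant. -/
lemma neg_mul_hamiltonian_le (hβ : 0 < β) (hb : 0 < b) (hab : b < a) (N : CycleCounts) :
    -β * hamiltonian α μ a b Λ m N
      ≤ β * volume.real Λ * ((μ - α) ^ 2 / (2 * (a - b))) := by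
  rw [hamiltonian_eq]
  have hV : 0 ≤ volume.real Λ := measureReal_nonneg
  have hQ := longCycleSquares_le Λ m N
  have hX := (pairDensity Λ m N).1.coe_nonneg
  have hY := (pairDensity Λ m N).2.coe_nonneg
  generalize ((pairDensity Λ m N).1 : ℝ) = X at *
  generalize ((pairDensity Λ m N).2 : ℝ) = Y at *
  have key : (μ - α) * (X + Y) - a / 2 * (X + Y) ^ 2 + b / 2 * longCycleSquares Λ m N
      ≤ (μ - α) ^ 2 / (2 * (a - b)) := by
    have hab' : 0 < a - b := sub_pos.2 hab
    have h1 : b / 2 * longCycleSquares Λ m N ≤ b / 2 * (X + Y) ^ 2 := by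
      have : Y ^ 2 ≤ (X + Y) ^ 2 := pow_le_pow_left₀ hY (by linarith) 2
      gcongr; linarith
    rw [le_div_iff₀ (by linarith)]
    nlinarith [sq_nonneg ((a - b) * (X + Y) - (μ - α))]
  calc _ = β * volume.real Λ *
        ((μ - α) * (X + Y) - a / 2 * (X + Y) ^ 2 + b / 2 * longCycleSquares Λ m N) := by ring
    _ ≤ _ := by gcongr

/-! ### The reference measure and the Gibbs measure -/

lemma refWeight_eq (β α : ℝ) (Λ : Set (EuclideanSpace ℝ (Fin d))) (N : CycleCounts) :
    refWeight β α Λ N = Real.exp (-(volume.real Λ * (qbar d β α).toReal)) *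
      cycleWeight (fun k => volume.real Λ * (q d β k * Real.exp (β * α * k))) N := rfl

lemma refWeight_nonneg (hβ : 0 < β) (N : CycleCounts) : 0 ≤ refWeight β α Λ N :=
  mul_nonneg (Real.exp_nonneg _) (cycleWeight_nonneg
    (fun k => mul_nonneg measureReal_nonneg (q_mul_exp_nonneg hβ α k)) N)

lemma isProbabilityMeasure_refMeasure (hd : 1 ≤ d) (hβ : 0 < β) (hα : α ≤ 0) :
    IsProbabilityMeasure (refMeasure β α Λ) := by
  refine HasSum.isProbabilityMeasure_sum_dirac (refWeight_nonneg hβ) ?_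
  have h := (hasSum_cycleWeight
    (x := fun k => volume.real Λ * (q d β k * Real.exp (β * α * k)))
    (fun k => mul_nonneg measureReal_nonneg (q_mul_exp_nonneg hβ α k))
    ((summable_q_mul_exp hd hβ hα).mul_left _)).mul_left
    (Real.exp (-(volume.real Λ * (qbar d β α).toReal)))
  rw [qbar_eq_ofReal hd hβ hα, ENNReal.toReal_ofReal (tsum_nonneg (q_mul_exp_nonneg hβ α)),
    tsum_mul_left, ← Real.exp_add, neg_add_cancel, Real.exp_zero] at h
  simp only [funext (refWeight_eq β α Λ), qbar_eq_ofReal hd hβ hα,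
    ENNReal.toReal_ofReal (tsum_nonneg (q_mul_exp_nonneg hβ α))]
  exact h

lemma integrable_exp_hamiltonian (hd : 1 ≤ d) (hβ : 0 < β) (hα : α ≤ 0) (hb : 0 < b)
    (hab : b < a) :
    Integrable (fun N => Real.exp (-β * hamiltonian α μ a b Λ m N)) (refMeasure β α Λ) := by
  have := isProbabilityMeasure_refMeasure (Λ := Λ) hd hβ hα
  refine Integrable.of_bound Measurable.of_discrete.aestronglyMeasurable
    (Real.exp (β * volume.real Λ * ((μ - α) ^ 2 / (2 * (a - b))))) (ae_of_all _ fun N => ?_)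
  rw [Real.norm_eq_abs, Real.abs_exp]
  exact Real.exp_le_exp.2 (neg_mul_hamiltonian_le hβ hb hab N)

lemma isProbabilityMeasure_pairLaw (hd : 1 ≤ d) (hβ : 0 < β) (hα : α ≤ 0) (hb : 0 < b)
    (hab : b < a) : IsProbabilityMeasure (pairLaw β α μ a b Λ m) := by
  have := isProbabilityMeasure_refMeasure (Λ := Λ) hd hβ hα
  have : IsProbabilityMeasure (gibbs β α μ a b Λ m) :=
    isProbabilityMeasure_tilted (integrable_exp_hamiltonian hd hβ hα hb hab)
  exact Measure.isProbabilityMeasure_map Measurable.of_discrete.aemeasurable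

/-! ### The law before normalisation -/

variable (β μ a b Λ m) in
/-- The contribution of a configuration to the partition function. -/
noncomputable def gibbsWeight (N : CycleCounts) : ℝ :=
  cycleWeight (fun k => volume.real Λ * q d β k) N *
    Real.exp (β * volume.real Λ * (μ * ((pairDensity Λ m N).1 + (pairDensity Λ m N).2)
      - a / 2 * ((pairDensity Λ m N).1 + (pairDensity Λ m N).2) ^ 2
      + b / 2 * longCycleSquares Λ m N))

/-- The tilt `e^{βαk}` of the reference weights is cancelled by `+α` times the total density in the
Hamiltonian. Hence `α` is absent from all estimates on `unnormalizedLaw`. -/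
lemma gibbsWeight_eq (hV : 0 < volume.real Λ) (N : CycleCounts) :
    gibbsWeight β μ a b Λ m N = Real.exp (volume.real Λ * (qbar d β α).toReal) *
      (refWeight β α Λ N * Real.exp (-β * hamiltonian α μ a b Λ m N)) := by
  have h1 := cycleWeight_mul_exp (fun k => volume.real Λ * q d β k) (fun k => β * α * k) N
  have h2 : (N.sum fun k j => β * α * (k : ℝ) * j)
      = β * α * (volume.real Λ * ((pairDensity Λ m N).1 + (pairDensity Λ m N).2)) := by
    rw [← sum_cycleDensity, Finset.mul_sum, Finset.mul_sum]
    refine Finset.sum_congr rfl fun k _ => ?_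
    rw [coe_cycleDensity]; field_simp
  simp only [mul_assoc (volume.real Λ)] at h1
  rw [refWeight_eq, h1, h2, gibbsWeight, hamiltonian_eq, ← mul_assoc, ← mul_assoc,
    ← Real.exp_add, add_neg_cancel, Real.exp_zero, one_mul, mul_assoc (cycleWeight _ _), ← Real.exp_add]
  congr 2
  ring

variable (β μ a b Λ m) in
/-- The unnormalised law of the pair empirical particle density; its total mass is the partition
function. -/
noncomputable def unnormalizedLaw : Measure (ℝ≥0 × ℝ≥0) :=
  (Measure.sum fun N => ENNReal.ofReal (gibbsWeight β μ a b Λ m N) • Measure.dirac N).map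
    (pairDensity Λ m)

open scoped Classical in
lemma unnormalizedLaw_apply {A : Set (ℝ≥0 × ℝ≥0)} (hA : MeasurableSet A) :
    unnormalizedLaw β μ a b Λ m A
      = ∑' N, if pairDensity Λ m N ∈ A then ENNReal.ofReal (gibbsWeight β μ a b Λ m N) else 0 := by
  rw [unnormalizedLaw, Measure.map_apply Measurable.of_discrete hA,
    Measure.sum_apply _ (MeasurableSet.of_discrete)]
  refine tsum_congr fun N => ?_
  by_cases h : pairDensity Λ m N ∈ A <;> simp [h]

lemma unnormalizedLaw_eq_lintegral (hβ : 0 < β) (hV : 0 < volume.real Λ)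
    {A : Set (ℝ≥0 × ℝ≥0)} (hA : MeasurableSet A) :
    unnormalizedLaw β μ a b Λ m A = ENNReal.ofReal (Real.exp (volume.real Λ * (qbar d β α).toReal))
      * ∫⁻ N in pairDensity Λ m ⁻¹' A, ENNReal.ofReal (Real.exp (-β * hamiltonian α μ a b Λ m N))
        ∂refMeasure β α Λ := by
  classical
  rw [unnormalizedLaw_apply hA, ← lintegral_indicator MeasurableSet.of_discrete, refMeasure,
    lintegral_sum_measure, ← ENNReal.tsum_mul_left]
  refine tsum_congr fun N => ?_
  rw [lintegral_smul_measure, lintegral_dirac, gibbsWeight_eq (α := α) hV,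
    ENNReal.ofReal_mul (Real.exp_nonneg _), ENNReal.ofReal_mul (refWeight_nonneg hβ N)]
  by_cases h : pairDensity Λ m N ∈ A <;> simp [h]

lemma unnormalizedLaw_univ (hd : 1 ≤ d) (hβ : 0 < β) (hα : α ≤ 0) (hb : 0 < b) (hab : b < a)
    (hV : 0 < volume.real Λ) :
    unnormalizedLaw β μ a b Λ m Set.univ
      = ENNReal.ofReal (partitionFunction β α μ a b Λ m) := by
  rw [unnormalizedLaw_eq_lintegral (α := α) hβ hV .univ, partitionFunction, Set.preimage_univ,
    Measure.restrict_univ, ENNReal.ofReal_mul (Real.exp_nonneg _),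
    ofReal_integral_eq_lintegral_ofReal (integrable_exp_hamiltonian hd hβ hα hb hab)
      (ae_of_all _ fun _ => Real.exp_nonneg _)]

lemma partitionFunction_pos (hd : 1 ≤ d) (hβ : 0 < β) (hα : α ≤ 0) (hb : 0 < b) (hab : b < a) :
    0 < partitionFunction β α μ a b Λ m := by
  have := isProbabilityMeasure_refMeasure (Λ := Λ) hd hβ hα
  exact mul_pos (Real.exp_pos _) (integral_exp_pos (integrable_exp_hamiltonian hd hβ hα hb hab))

lemma pairLaw_apply (hd : 1 ≤ d) (hβ : 0 < β) (hα : α ≤ 0) (hb : 0 < b) (hab : b < a)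
    (hV : 0 < volume.real Λ) {A : Set (ℝ≥0 × ℝ≥0)} (hA : MeasurableSet A) :
    pairLaw β α μ a b Λ m A = unnormalizedLaw β μ a b Λ m A
      / ENNReal.ofReal (partitionFunction β α μ a b Λ m) := by
  have := isProbabilityMeasure_refMeasure (Λ := Λ) hd hβ hα
  have hI := integral_exp_pos (integrable_exp_hamiltonian (Λ := Λ) (m := m) (μ := μ) hd hβ hα hb hab)
  rw [pairLaw, Measure.map_apply Measurable.of_discrete hA, gibbs,
    tilted_apply' _ _ MeasurableSet.of_discrete, unnormalizedLaw_eq_lintegral (α := α) hβ hV hA,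
    partitionFunction, ENNReal.ofReal_mul (Real.exp_nonneg _),
    ENNReal.mul_div_mul_left _ _ (by simp [Real.exp_pos]) ENNReal.ofReal_ne_top]
  simp_rw [ENNReal.ofReal_div_of_pos hI, div_eq_mul_inv]
  rw [lintegral_mul_const _ Measurable.of_discrete]

end HYL

namespace HYL

/-! ### The upper bound -/

/-- The mean-field energy gain per volume at particle densities `z`. -/
noncomputable def energyGain (μ a b : ℝ) (z : ℝ≥0 × ℝ≥0) : ℝ :=
  μ * (z.1 + z.2) - a / 2 * (z.1 + z.2) ^ 2 + b / 2 * z.2 ^ 2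

/-- The functional whose supremum over `K κ` is the pressure. -/
noncomputable def pressureFunctional (d : ℕ) (β μ a b : ℝ) (z : ℝ≥0 × ℝ≥0) : ℝ :=
  energyGain μ a b z - freeEnergy d β z.1

/-- The total weight of the cycles of length at least `m`. -/
noncomputable def qTail (d : ℕ) (β : ℝ) (m : ℕ) : ℝ :=
  ∑' k : ℕ+, if m ≤ (k : ℕ) then q d β k else 0

variable {d : ℕ} {β μ a b : ℝ}

@[fun_prop]
lemma continuous_energyGain : Continuous (energyGain μ a b) := by
  unfold energyGain; fun_prop

lemma energyGain_le (hb : 0 < b) (z : ℝ≥0 × ℝ≥0) :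
    energyGain μ a b z ≤ μ * (z.1 + z.2) - (a - b) / 2 * ((z.1 : ℝ) + z.2) ^ 2 := by
  unfold energyGain
  have hX := z.1.coe_nonneg
  have hY := z.2.coe_nonneg
  have : (z.2 : ℝ) ^ 2 ≤ (z.1 + z.2) ^ 2 := pow_le_pow_left₀ hY (by linarith) 2
  nlinarith

lemma exists_energyGain_le (hb : 0 < b) (hab : b < a) (T : ℝ) :
    ∃ R : ℝ, ∀ z : ℝ≥0 × ℝ≥0, R ≤ z.1 + z.2 → energyGain μ a b z ≤ T := by
  have he : 0 < (a - b) / 2 := by linarith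
  have h1 : Tendsto (fun t : ℝ => t * (μ - (a - b) / 2 * t)) atTop atBot :=
    tendsto_id.atTop_mul_atBot₀ (tendsto_atBot_add_const_left _ μ
      ((tendsto_id.const_mul_atTop he).const_mul_atTop_of_neg neg_one_lt_zero) |>.congr
        fun t => by simp [sub_eq_add_neg])
  obtain ⟨R, hR⟩ := eventually_atTop.1 (h1.eventually_le_atBot T)
  refine ⟨R, fun z hz => (energyGain_le hb z).trans (le_trans (le_of_eq ?_) (hR _ hz))⟩
  ring

lemma energyGain_le_const (hb : 0 < b) (hab : b < a) (z : ℝ≥0 × ℝ≥0) :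
    energyGain μ a b z ≤ μ ^ 2 / (2 * (a - b)) := by
  refine (energyGain_le hb z).trans ?_
  have hab' : 0 < a - b := sub_pos.2 hab
  rw [le_div_iff₀ (by linarith)]
  nlinarith [sq_nonneg ((a - b) * (z.1 + z.2) - μ)]

lemma tendsto_qTail (hd : 1 ≤ d) (hβ : 0 < β) : Tendsto (qTail d β) atTop (𝓝 0) := by
  have := tendsto_tsum_of_dominated_convergence (𝓕 := atTop) (bound := q d β)
    (f := fun (m : ℕ) (k : ℕ+) => if m ≤ (k : ℕ) then q d β k else 0) (g := fun _ => 0)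
    (summable_q hd)
    (fun k => tendsto_const_nhds.congr' <| by
      filter_upwards [eventually_gt_atTop (k : ℕ)] with m hm
      simp [not_le.2 hm])
    (Eventually.of_forall fun m k => by
      have := (q_pos (d := d) hβ k).le
      split_ifs <;> simp [abs_of_nonneg, this])
  rw [tsum_zero] at this
  exact this

/-! ### Exponential tilting in a fixed box -/

section Fixed

variable {Λ : Set (EuclideanSpace ℝ (Fin d))} {m : ℕ}

/-- A Chernoff bound: `e^{βVsX}` is inserted and compensated through `B`, the sum is extended from
`S` to all configurations, and the tilted Poisson weights are summed exactly. -/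
lemma unnormalizedLaw_le (hd : 1 ≤ d) (hβ : 0 < β) (hb : 0 < b) (hV : 0 < volume.real Λ)
    {S : Set (ℝ≥0 × ℝ≥0)} (hS : MeasurableSet S) {s B : ℝ} (hs : s ≤ 0)
    (hB : ∀ z ∈ S, energyGain μ a b z - s * z.1 ≤ B) :
    unnormalizedLaw β μ a b Λ m S ≤ ENNReal.ofReal
      (Real.exp (volume.real Λ * (β * (B + idealPressure d β s) + qTail d β m))) := by
  classical
  set V := volume.real Λ with hVdef
  -- Only lengths below `m` are tilted, since `s` is dual to the short-cycle density alone; the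
  -- remaining lengths keep weight `V q_k` and add up to `V * qTail d β m`.
  set y : ℕ+ → ℝ := fun k =>
    V * q d β k * Real.exp (if (k : ℕ) < m then β * s * k else 0) with hy
  have hy0 : ∀ k, 0 ≤ y k := fun k =>
    mul_nonneg (mul_nonneg hV.le (q_pos hβ k).le) (Real.exp_nonneg _)
  have htail : Summable fun k : ℕ+ => if m ≤ (k : ℕ) then q d β k else 0 :=
    (summable_q (β := β) hd).of_nonneg_of_le
      (fun k => by have := (q_pos (d := d) hβ k).le; split_ifs <;> simp [this])
      (fun k => by have := (q_pos (d := d) hβ k).le; split_ifs <;> simp [this])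
  have hsum := ((summable_q_mul_exp (d := d) hd hβ hs).add htail).mul_left V
  have hyle : ∀ k, y k ≤ V * (q d β k * Real.exp (β * s * k)
      + if m ≤ (k : ℕ) then q d β k else 0) := by
    intro k
    simp only [hy, mul_assoc]
    refine mul_le_mul_of_nonneg_left ?_ hV.le
    rcases lt_or_ge (k : ℕ) m with h | h
    · simp [h, not_le.2 h]
    · simp [h, not_lt.2 h, mul_nonneg, (q_pos (d := d) hβ k).le, Real.exp_nonneg]
  have hys : Summable y := hsum.of_nonneg_of_le hy0 hyle
  have hweight : ∀ N, pairDensity Λ m N ∈ S → gibbsWeight β μ a b Λ m N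
      ≤ cycleWeight y N * Real.exp (V * (β * B)) := by
    intro N hN
    have h1 := cycleWeight_mul_exp (fun k => V * q d β k)
      (fun k => if (k : ℕ) < m then β * s * k else 0) N
    have h2 : (N.sum fun k j => (if (k : ℕ) < m then β * s * (k : ℝ) else 0) * (j : ℝ))
        = V * (β * (s * (pairDensity Λ m N).1)) := by
      rw [coe_pairDensity_fst, Finsupp.sum, Finsupp.sum, Finset.mul_sum, Finset.mul_sum,
        Finset.mul_sum]
      refine Finset.sum_congr rfl fun k _ => ?_
      split_ifs
      · rw [← hVdef]; field_simp
      · simp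
    rw [hy, h1, h2, gibbsWeight, ← hVdef, mul_assoc (cycleWeight _ _), ← Real.exp_add]
    refine mul_le_mul_of_nonneg_left (Real.exp_le_exp.2 ?_) (cycleWeight_nonneg
      (fun k => mul_nonneg hV.le (q_pos hβ k).le) N)
    have h3 := hB _ hN
    have h4 := longCycleSquares_le Λ m N
    rw [← mul_add, ← mul_add, mul_comm β V, mul_assoc]
    refine mul_le_mul_of_nonneg_left (mul_le_mul_of_nonneg_left ?_ hβ.le) hV.le
    unfold energyGain at h3
    nlinarith
  calc unnormalizedLaw β μ a b Λ m S
      ≤ ∑' N, ENNReal.ofReal (cycleWeight y N) * ENNReal.ofReal (Real.exp (V * (β * B))) := by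
        rw [unnormalizedLaw_apply hS]
        refine ENNReal.tsum_le_tsum fun N => ?_
        split_ifs with h
        · rw [← ENNReal.ofReal_mul (cycleWeight_nonneg hy0 N)]
          exact ENNReal.ofReal_le_ofReal (hweight N h)
        · exact zero_le
    _ = ENNReal.ofReal (Real.exp (∑' k, y k + V * (β * B))) := by
        rw [ENNReal.tsum_mul_right, tsum_ofReal_cycleWeight hy0 hys,
          ← ENNReal.ofReal_mul (Real.exp_nonneg _), Real.exp_add]
    _ ≤ _ := by
        refine ENNReal.ofReal_le_ofReal (Real.exp_le_exp.2 ?_)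
        have h5 := hys.tsum_le_tsum hyle hsum
        rw [tsum_mul_left, (summable_q_mul_exp (d := d) hd hβ hs).tsum_add htail,
          ← mul_idealPressure hβ] at h5
        unfold qTail
        linarith

/-- A single cycle of length at least `m` already has density at least `m / |Λ|`. This gap produces
the set `K κ` in the limit. -/
lemma pairDensity_snd_eq_zero_or_le (N : CycleCounts) :
    (pairDensity Λ m N).2 = 0 ∨ (m : ℝ) / volume.real Λ ≤ (pairDensity Λ m N).2 := by
  rcases eq_or_ne (pairDensity Λ m N).2 0 with h | h
  · exact .inl h
  · right
    obtain ⟨k, hk, -⟩ := Finset.exists_ne_zero_of_sum_ne_zero h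
    obtain ⟨hk1, hk2⟩ := Finset.mem_filter.1 hk
    have hV : 0 ≤ volume.real Λ := measureReal_nonneg
    have hN : (1 : ℝ) ≤ N k := by
      exact_mod_cast Nat.one_le_iff_ne_zero.2 (Finsupp.mem_support_iff.1 hk1)
    rw [coe_pairDensity_snd]
    calc (m : ℝ) / volume.real Λ ≤ (k : ℝ) * (N k / volume.real Λ) := by
          have : (m : ℝ) ≤ (k : ℕ) := by exact_mod_cast hk2
          rw [← mul_div_assoc]
          gcongr
          nlinarith
      _ = if m ≤ (k : ℕ) then (k : ℝ) * (N k / volume.real Λ) else 0 := (if_pos hk2).symm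
      _ ≤ _ := Finset.single_le_sum
          (f := fun k : ℕ+ => if m ≤ (k : ℕ) then (k : ℝ) * (N k / volume.real Λ) else 0)
          (fun k _ => by split_ifs <;> positivity) hk1

end Fixed

/-! ### From local bounds to closed sets -/

section Sequence

variable {Λ : ℕ → Set (EuclideanSpace ℝ (Fin d))} {m : ℕ → ℕ} {κ : ℝ≥0∞}

/-- A slope `s` nearly optimal in `freeEnergy` at `z` is frozen; the tilted exponent is continuous,
so its bound persists near `z`. The slack left below `c` absorbs `qTail`. -/
lemma exists_nhds_unnormalizedLaw_le (hd : 1 ≤ d) (hβ : 0 < β) (hb : 0 < b)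
    (hvol : Tendsto (fun n => volume.real (Λ n)) atTop atTop) (hm : Tendsto m atTop atTop)
    {z : ℝ≥0 × ℝ≥0} {c : ℝ} (hc : pressureFunctional d β μ a b z < c) :
    ∃ U ∈ 𝓝 z, ∀ᶠ n in atTop, unnormalizedLaw β μ a b (Λ n) (m n) U
      ≤ ENNReal.ofReal (Real.exp (β * volume.real (Λ n) * c)) := by
  have hc' : energyGain μ a b z - c < freeEnergy d β z.1 := by
    unfold pressureFunctional at hc; linarith
  obtain ⟨s, hs, hlt⟩ := exists_lt_of_lt_freeEnergy hc'
  obtain ⟨B, hB1, hB2⟩ := exists_between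
    (show energyGain μ a b z - s * z.1 < c - idealPressure d β s by linarith)
  have hopen : IsOpen {w : ℝ≥0 × ℝ≥0 | energyGain μ a b w - s * w.1 < B} :=
    isOpen_lt (by fun_prop) continuous_const
  refine ⟨_, hopen.mem_nhds hB1, ?_⟩
  filter_upwards [hvol.eventually_gt_atTop 0, ((tendsto_qTail (d := d) hd hβ).comp
    hm).eventually_lt_const (show 0 < β * (c - idealPressure d β s - B) from
      mul_pos hβ (by linarith))] with n hV htail
  refine (unnormalizedLaw_le hd hβ hb hV hopen.measurableSet hs fun w hw => le_of_lt hw).trans ?_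
  refine ENNReal.ofReal_le_ofReal (Real.exp_le_exp.2 ?_)
  rw [mul_comm β (volume.real (Λ n)), mul_assoc]
  refine mul_le_mul_of_nonneg_left ?_ hV.le
  simp only [Function.comp] at htail
  linarith

lemma exists_nhds_unnormalizedLaw_eq_zero
    (hvol : Tendsto (fun n => volume.real (Λ n)) atTop atTop)
    (hκ : Tendsto (fun n => (m n : ℝ≥0∞) / volume (Λ n)) atTop (𝓝 κ))
    {z : ℝ≥0 × ℝ≥0} (hz : z ∉ K κ) :
    ∃ U ∈ 𝓝 z, ∀ᶠ n in atTop, unnormalizedLaw β μ a b (Λ n) (m n) U = 0 := by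
  simp only [K, Set.mem_ofPred_eq, not_or, not_le] at hz
  -- With `z.2 < r < κ`, the gap `m n / |Λ n|` eventually exceeds `r`, so no configuration has
  -- long-cycle density in `(0, r)`.
  obtain ⟨r, hr1, hr2⟩ := ENNReal.lt_iff_exists_nnreal_btwn.1 hz.2
  have hopen : IsOpen {w : ℝ≥0 × ℝ≥0 | 0 < w.2 ∧ w.2 < r} :=
    (isOpen_lt continuous_const continuous_snd).inter (isOpen_lt (NNReal.continuous_coe.comp continuous_snd)
      (continuous_const (y := (r : ℝ))))
  refine ⟨_, hopen.mem_nhds ⟨pos_iff_ne_zero.2 hz.1, by exact_mod_cast hr1⟩, ?_⟩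
  filter_upwards [hvol.eventually_gt_atTop 0, hκ.eventually_const_lt hr2] with n hV hn
  classical
  rw [unnormalizedLaw_apply hopen.measurableSet, ENNReal.tsum_eq_zero]
  intro N
  refine if_neg fun hN => ?_
  have hr : (r : ℝ) < m n / volume.real (Λ n) := by
    have := ENNReal.toReal_strict_mono (ENNReal.div_ne_top (ENNReal.natCast_ne_top _)
      fun h => by simp [Measure.real, h] at hV) hn
    simpa [Measure.real] using this
  rcases pairDensity_snd_eq_zero_or_le (Λ := Λ n) (m := m n) N with h | h
  · exact hN.1.ne' h
  · exact absurd (hr.trans_le h) (not_lt.2 (NNReal.coe_le_coe.2 hN.2.le))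

lemma eventually_two_mul_exp_le (hβ : 0 < β)
    (hvol : Tendsto (fun n => volume.real (Λ n)) atTop atTop) {c c' : ℝ} (h : c < c') :
    ∀ᶠ n in atTop, 2 * Real.exp (β * volume.real (Λ n) * c)
      ≤ Real.exp (β * volume.real (Λ n) * c') := by
  filter_upwards [(hvol.const_mul_atTop (mul_pos hβ (sub_pos.2 h))).eventually_ge_atTop 1]
    with n hn
  have h1 := Real.add_one_le_exp (β * (c' - c) * volume.real (Λ n))
  have h2 : Real.exp (β * volume.real (Λ n) * c') = Real.exp (β * (c' - c) * volume.real (Λ n))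
      * Real.exp (β * volume.real (Λ n) * c) := by rw [← Real.exp_add]; ring_nf
  rw [h2]
  exact mul_le_mul_of_nonneg_right (by linarith) (Real.exp_nonneg _)

lemma eventually_union_le (hβ : 0 < β)
    (hvol : Tendsto (fun n => volume.real (Λ n)) atTop atTop) {c₁ c₂ c : ℝ} (h₁ : c₁ < c)
    (h₂ : c₂ < c) {S T : Set (ℝ≥0 × ℝ≥0)}
    (hS : ∀ᶠ n in atTop, unnormalizedLaw β μ a b (Λ n) (m n) S
      ≤ ENNReal.ofReal (Real.exp (β * volume.real (Λ n) * c₁)))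
    (hT : ∀ᶠ n in atTop, unnormalizedLaw β μ a b (Λ n) (m n) T
      ≤ ENNReal.ofReal (Real.exp (β * volume.real (Λ n) * c₂))) :
    ∀ᶠ n in atTop, unnormalizedLaw β μ a b (Λ n) (m n) (S ∪ T)
      ≤ ENNReal.ofReal (Real.exp (β * volume.real (Λ n) * c)) := by
  filter_upwards [hS, hT, eventually_two_mul_exp_le hβ hvol h₁,
    eventually_two_mul_exp_le hβ hvol h₂] with n h3 h4 h5 h6
  refine (measure_union_le S T).trans ((add_le_add h3 h4).trans ?_)
  rw [← ENNReal.ofReal_add (Real.exp_nonneg _) (Real.exp_nonneg _)]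
  exact ENNReal.ofReal_le_ofReal (by linarith)

theorem eventually_unnormalizedLaw_le (hd : 1 ≤ d) (hβ : 0 < β) (hb : 0 < b) (hab : b < a)
    (hvol : Tendsto (fun n => volume.real (Λ n)) atTop atTop) (hm : Tendsto m atTop atTop)
    (hκ : Tendsto (fun n => (m n : ℝ≥0∞) / volume (Λ n)) atTop (𝓝 κ))
    {C : Set (ℝ≥0 × ℝ≥0)} (hC : IsClosed C) {c c' : ℝ} (hcc : c < c')
    (hc : ∀ z ∈ C, z ∈ K κ → pressureFunctional d β μ a b z ≤ c) :
    ∀ᶠ n in atTop, unnormalizedLaw β μ a b (Λ n) (m n) C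
      ≤ ENNReal.ofReal (Real.exp (β * volume.real (Λ n) * c')) := by
  obtain ⟨c₁, h1, h2⟩ := exists_between hcc
  -- The region of large total density is treated with slope `s = 0`; subtracting `idealPressure d β
  -- 0` here makes the resulting exponent exactly `c`, up to `qTail`.
  obtain ⟨R, hR⟩ := exists_energyGain_le (μ := μ) hb hab (c - idealPressure d β 0)
  set T : Set (ℝ≥0 × ℝ≥0) := {z | R ≤ (z.1 : ℝ) + z.2} with hT
  have hTm : MeasurableSet T :=
    (isClosed_le continuous_const (by fun_prop)).measurableSet
  have hTle : ∀ᶠ n in atTop, unnormalizedLaw β μ a b (Λ n) (m n) T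
      ≤ ENNReal.ofReal (Real.exp (β * volume.real (Λ n) * c₁)) := by
    filter_upwards [hvol.eventually_gt_atTop 0, ((tendsto_qTail (d := d) hd hβ).comp
      hm).eventually_lt_const (show 0 < β * (c₁ - c) from mul_pos hβ (by linarith))]
      with n hV htail
    refine (unnormalizedLaw_le hd hβ hb hV hTm le_rfl
      fun z hz => by simpa using hR z hz).trans ?_
    refine ENNReal.ofReal_le_ofReal (Real.exp_le_exp.2 ?_)
    rw [mul_comm β (volume.real (Λ n)), mul_assoc]
    refine mul_le_mul_of_nonneg_left ?_ hV.le
    simp only [Function.comp] at htail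
    linarith
  have hcomp : IsCompact (C ∩ {z : ℝ≥0 × ℝ≥0 | (z.1 : ℝ) + z.2 ≤ R}) := by
    refine (isCompact_Icc (a := (0 : ℝ≥0 × ℝ≥0)) (b := (R.toNNReal, R.toNNReal))).of_isClosed_subset
      (hC.inter (isClosed_le (by fun_prop) continuous_const)) ?_
    rintro z ⟨-, hz⟩
    have hX := z.1.coe_nonneg
    have hY := z.2.coe_nonneg
    simp only [Set.mem_ofPred_eq] at hz
    refine ⟨zero_le, Prod.mk_le_mk.2 ⟨?_, ?_⟩⟩ <;> apply NNReal.le_toNNReal_of_coe_le <;> linarith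
  -- The rate `c₂` is existential because each union costs a factor `2`, which is absorbed by a
  -- slightly larger rate still below `c'`.
  obtain ⟨c₂, h3, hCle⟩ : ∃ c₂ < c', ∀ᶠ n in atTop, unnormalizedLaw β μ a b (Λ n) (m n)
      (C ∩ {z : ℝ≥0 × ℝ≥0 | (z.1 : ℝ) + z.2 ≤ R})
      ≤ ENNReal.ofReal (Real.exp (β * volume.real (Λ n) * c₂)) := by
    refine hcomp.induction_on (p := fun S => ∃ c₂ < c', ∀ᶠ n in atTop,
      unnormalizedLaw β μ a b (Λ n) (m n) S
        ≤ ENNReal.ofReal (Real.exp (β * volume.real (Λ n) * c₂))) ?_ ?_ ?_ ?_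
    · exact ⟨c₁, h2, by simp⟩
    · rintro S T hST ⟨c₂, hc₂, hT⟩
      exact ⟨c₂, hc₂, hT.mono fun n hn => (measure_mono hST).trans hn⟩
    · rintro S T ⟨c₂, hc₂, hS⟩ ⟨c₃, hc₃, hT⟩
      obtain ⟨c₄, h4, h5⟩ := exists_between (max_lt hc₂ hc₃)
      rw [max_lt_iff] at h4
      exact ⟨c₄, h5, eventually_union_le hβ hvol h4.1 h4.2 hS hT⟩
    · rintro z ⟨hz, -⟩
      by_cases hzK : z ∈ K κ
      · obtain ⟨U, hU, h⟩ := exists_nhds_unnormalizedLaw_le hd hβ hb hvol hm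
          ((hc z hz hzK).trans_lt h1)
        exact ⟨U, mem_nhdsWithin_of_mem_nhds hU, c₁, h2, h⟩
      · obtain ⟨U, hU, h⟩ := exists_nhds_unnormalizedLaw_eq_zero (β := β) (μ := μ) (a := a)
          (b := b) hvol hκ hzK
        exact ⟨U, mem_nhdsWithin_of_mem_nhds hU, c₁, h2, h.mono fun n hn => by simp [hn]⟩
  refine (eventually_union_le hβ hvol h3 h2 hCle hTle).mono fun n hn =>
    (measure_mono fun z hz => ?_).trans hn
  rcases le_total ((z.1 : ℝ) + z.2) R with h | h
  · exact .inl ⟨hz, h⟩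
  · exact .inr h

end Sequence

end HYL

namespace HYL

/-! ### The lower bound -/

lemma tendsto_log_div_atTop : Tendsto (fun x : ℝ => Real.log x / x) atTop (𝓝 0) := by
  simpa using Real.tendsto_pow_log_div_mul_add_atTop 1 0 1 one_ne_zero

/-- Stirling's formula: the limit is minus the Poisson relative entropy density, without its
additive constant `q`. -/
lemma tendsto_log_pow_div_factorial {q t : ℝ} (hq : 0 < q) (ht : 0 < t) :
    Tendsto (fun V : ℝ =>
      Real.log ((V * q) ^ ⌊t * V⌋₊ / ((⌊t * V⌋₊).factorial : ℝ)) / V) atTop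
      (𝓝 (t * Real.log (q / t) + t)) := by
  have hfl : Tendsto (fun V : ℝ => (⌊t * V⌋₊ : ℝ) / V) atTop (𝓝 t) :=
    tendsto_nat_floor_mul_div_atTop ht.le
  have hN : Tendsto (fun V : ℝ => ⌊t * V⌋₊) atTop atTop :=
    tendsto_nat_floor_atTop.comp (tendsto_id.const_mul_atTop ht)
  have hNr : Tendsto (fun V : ℝ => (⌊t * V⌋₊ : ℝ)) atTop atTop :=
    tendsto_natCast_atTop_atTop.comp hN
  have h1 : Tendsto (fun V : ℝ => Real.log (2 * ⌊t * V⌋₊) / V) atTop (𝓝 0) := by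
    have := (tendsto_log_div_atTop.comp (hNr.const_mul_atTop two_pos)).mul (hfl.const_mul 2)
    rw [zero_mul] at this
    refine this.congr' ?_
    filter_upwards [hNr.eventually_gt_atTop 0, eventually_gt_atTop 0] with V hV hV'
    simp only [Function.comp]
    field_simp
  have h2 : Tendsto (fun V : ℝ => Real.log (Stirling.stirlingSeq ⌊t * V⌋₊) / V) atTop (𝓝 0) :=
    ((Stirling.tendsto_stirlingSeq_sqrt_pi.comp hN).log
      (Real.sqrt_ne_zero'.2 Real.pi_pos)).div_atTop tendsto_id
  have h3 := ((hfl.mul (((hfl.log ht.ne').const_sub (Real.log q)).add_const 1)).sub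
    (h1.const_mul (1 / 2))).sub h2
  rw [mul_zero, sub_zero, sub_zero, mul_add, mul_one, ← Real.log_div hq.ne' ht.ne'] at h3
  refine h3.congr' ?_
  filter_upwards [hNr.eventually_gt_atTop 0, eventually_gt_atTop 0] with V hV hV'
  have h4 := Stirling.log_stirlingSeq_formula ⌊t * V⌋₊
  rw [h4, Real.log_div (pow_ne_zero _ (mul_pos hV' hq).ne') (by positivity), Real.log_pow,
    Real.log_mul hV'.ne' hq.ne', Real.log_div hV.ne' hV'.ne',
    Real.log_div hV.ne' (Real.exp_pos 1).ne', Real.log_exp]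
  field_simp
  ring

/-- The weight `q_k` decays only polynomially, so a cycle of length proportional to the volume costs
`O(log V)` in the exponent. -/
lemma tendsto_log_single_cycle (d : ℕ) {β y : ℝ} (hβ : 0 < β) (hy : 0 < y) :
    Tendsto (fun V : ℝ => Real.log (V * q d β (⌈y * V⌉₊).toPNat') / V) atTop (𝓝 0) := by
  have hce : Tendsto (fun V : ℝ => (⌈y * V⌉₊ : ℝ) / V) atTop (𝓝 y) :=
    tendsto_nat_ceil_mul_div_atTop hy.le
  have hN : Tendsto (fun V : ℝ => (⌈y * V⌉₊ : ℝ)) atTop atTop :=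
    tendsto_natCast_atTop_atTop.comp
      (tendsto_nat_ceil_atTop.comp (tendsto_id.const_mul_atTop hy))
  have h1 : Tendsto (fun V : ℝ => Real.log ⌈y * V⌉₊ / V) atTop (𝓝 0) := by
    have := (tendsto_log_div_atTop.comp hN).mul hce
    rw [zero_mul] at this
    refine this.congr' ?_
    filter_upwards [hN.eventually_gt_atTop 0, eventually_gt_atTop 0] with V hV hV'
    simp only [Function.comp]
    field_simp
  have hA : (0 : ℝ) < (4 * Real.pi * β) ^ ((d : ℝ) / 2) := by positivity
  have h2 := (tendsto_log_div_atTop.sub ((tendsto_const_nhds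
    (x := Real.log ((4 * Real.pi * β) ^ ((d : ℝ) / 2)))).div_atTop tendsto_id)).sub
    (h1.const_mul (1 + (d : ℝ) / 2))
  rw [mul_zero, sub_zero, sub_zero] at h2
  refine h2.congr' ?_
  filter_upwards [hN.eventually_gt_atTop 0, eventually_gt_atTop 0] with V hV hV'
  have hpos : 0 < ⌈y * V⌉₊ := by exact_mod_cast hV
  have hp : (0 : ℝ) < (⌈y * V⌉₊ : ℝ) ^ (1 + (d : ℝ) / 2) := by positivity
  rw [q, Nat.toPNat'_coe, if_pos hpos, Real.log_mul hV'.ne' (by positivity), one_div,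
    Real.log_inv, Real.log_mul hA.ne' hp.ne', Real.log_rpow hV]
  simp only [id]
  field_simp
  ring

/-- The configuration with `⌊t_k V⌋` cycles of length `k` for each `k ≤ L`. -/
noncomputable def shortCycles (t : ℕ+ → ℝ) (L : ℕ+) (V : ℝ) : CycleCounts :=
  Finsupp.indicator (Finset.Icc 1 L) fun k _ => ⌊t k * V⌋₊

variable {d : ℕ} {β μ a b : ℝ}

lemma shortCycles_sum (t : ℕ+ → ℝ) (L : ℕ+) (V : ℝ) (g : ℕ+ → ℕ → ℝ) (hg : ∀ k, g k 0 = 0) :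
    (shortCycles t L V).sum g = ∑ k ∈ Finset.Icc 1 L, g k ⌊t k * V⌋₊ := by
  classical
  exact Finsupp.sum_indicator_index _ fun k _ => hg k

lemma cycleWeight_shortCycles (x t : ℕ+ → ℝ) (L : ℕ+) (V : ℝ) :
    cycleWeight x (shortCycles t L V)
      = ∏ k ∈ Finset.Icc 1 L, x k ^ ⌊t k * V⌋₊ / ((⌊t k * V⌋₊).factorial : ℝ) := by
  classical
  exact Finsupp.prod_indicator_index _ fun k _ => by simp

lemma le_of_mem_support_shortCycles {t : ℕ+ → ℝ} {L : ℕ+} {V : ℝ} {k : ℕ+}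
    (hk : k ∈ (shortCycles t L V).support) : k ≤ L :=
  (Finset.mem_Icc.1 (Finsupp.support_indicator_subset _ _ hk)).2

lemma cycleWeight_pos {x : ℕ+ → ℝ} (hx : ∀ k, 0 < x k) (N : CycleCounts) :
    0 < cycleWeight x N :=
  Finset.prod_pos fun k _ => by have := hx k; positivity

lemma tendsto_log_cycleWeight_shortCycles (hβ : 0 < β) {t : ℕ+ → ℝ} (ht : ∀ k, 0 < t k)
    (L : ℕ+) :
    Tendsto (fun V : ℝ => Real.log (cycleWeight (fun k => V * q d β k) (shortCycles t L V)) / V)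
      atTop (𝓝 (∑ k ∈ Finset.Icc 1 L, (t k * Real.log (q d β k / t k) + t k))) := by
  have h := tendsto_finsetSum (Finset.Icc 1 L) fun k _ =>
    tendsto_log_pow_div_factorial (q_pos (d := d) hβ k) (ht k)
  refine h.congr' ?_
  filter_upwards [eventually_gt_atTop 0] with V hV
  rw [cycleWeight_shortCycles, Real.log_prod fun k _ => ?_, Finset.sum_div]
  have := q_pos (d := d) hβ k
  positivity

/-! ### Densities and weights of the trial configurations -/

section Fixed

variable {Λ : Set (EuclideanSpace ℝ (Fin d))} {m : ℕ} {t : ℕ+ → ℝ} {L : ℕ+} {V : ℝ}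

lemma pairDensity_shortCycles_fst (hL : (L : ℕ) < m) :
    ((pairDensity Λ m (shortCycles t L V)).1 : ℝ)
      = ∑ k ∈ Finset.Icc 1 L, (k : ℝ) * (⌊t k * V⌋₊ / volume.real Λ) := by
  rw [coe_pairDensity_fst, shortCycles_sum _ _ _ _ (by simp)]
  refine Finset.sum_congr rfl fun k hk => if_pos (lt_of_le_of_lt ?_ hL)
  exact_mod_cast (Finset.mem_Icc.1 hk).2

lemma pairDensity_shortCycles_snd (hL : (L : ℕ) < m) :
    ((pairDensity Λ m (shortCycles t L V)).2 : ℝ) = 0 := by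
  rw [coe_pairDensity_snd, shortCycles_sum _ _ _ _ (by simp)]
  refine Finset.sum_eq_zero fun k hk => if_neg (not_le.2 (lt_of_le_of_lt ?_ hL))
  exact_mod_cast (Finset.mem_Icc.1 hk).2

lemma longCycleSquares_shortCycles (hL : (L : ℕ) < m) :
    longCycleSquares Λ m (shortCycles t L V) = 0 := by
  rw [longCycleSquares, shortCycles_sum _ _ _ _ (by simp)]
  refine Finset.sum_eq_zero fun k hk => if_neg (not_le.2 (lt_of_le_of_lt ?_ hL))
  exact_mod_cast (Finset.mem_Icc.1 hk).2

lemma disjoint_support_shortCycles_single {k : ℕ+} (hk : L < k) :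
    Disjoint (shortCycles t L V).support (Finsupp.single k 1 : CycleCounts).support := by
  rw [Finset.disjoint_left]
  intro i hi hi'
  rw [Finset.mem_singleton.1 (Finsupp.support_single_subset hi')] at hi
  exact absurd hk (not_lt.2 (le_of_mem_support_shortCycles hi))

lemma pairDensity_add_single_fst {k : ℕ+} (hk : m ≤ (k : ℕ)) (N : CycleCounts) :
    ((pairDensity Λ m (N + Finsupp.single k 1)).1 : ℝ) = (pairDensity Λ m N).1 := by
  rw [coe_pairDensity_fst, coe_pairDensity_fst, Finsupp.sum_add_index' (by simp)
    (fun k i j => by split_ifs <;> push_cast <;> ring), Finsupp.sum_single_index (by simp),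
    if_neg (not_lt.2 hk), add_zero]

lemma pairDensity_add_single_snd {k : ℕ+} (hk : m ≤ (k : ℕ)) (N : CycleCounts) :
    ((pairDensity Λ m (N + Finsupp.single k 1)).2 : ℝ)
      = (pairDensity Λ m N).2 + (k : ℝ) / volume.real Λ := by
  rw [coe_pairDensity_snd, coe_pairDensity_snd, Finsupp.sum_add_index' (by simp)
    (fun k i j => by split_ifs <;> push_cast <;> ring), Finsupp.sum_single_index (by simp),
    if_pos hk, Nat.cast_one, mul_one_div]

lemma longCycleSquares_shortCycles_add_single (hL : (L : ℕ) < m) {k : ℕ+} (hk : m ≤ (k : ℕ)) :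
    longCycleSquares Λ m (shortCycles t L V + Finsupp.single k 1)
      = ((k : ℝ) / volume.real Λ) ^ 2 := by
  have h := longCycleSquares_shortCycles (Λ := Λ) (t := t) (V := V) hL
  rw [longCycleSquares] at h
  rw [longCycleSquares, Finsupp.sum_add_index_of_disjoint
    (disjoint_support_shortCycles_single (PNat.coe_lt_coe _ _ |>.1 (hL.trans_le hk))), h,
    Finsupp.sum_single_index (by simp), if_pos hk, Nat.cast_one, mul_one_div, zero_add]

lemma cycleWeight_shortCycles_add_single (x : ℕ+ → ℝ) {k : ℕ+} (hk : L < k) :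
    cycleWeight x (shortCycles t L V + Finsupp.single k 1)
      = cycleWeight x (shortCycles t L V) * x k := by
  rw [cycleWeight, Finsupp.prod_add_index_of_disjoint (disjoint_support_shortCycles_single hk),
    Finsupp.prod_single_index (by simp), pow_one, Nat.factorial_one, Nat.cast_one, div_one]
  rfl

end Fixed

/-! ### Trial configurations along the sequence -/

section Sequence

variable {Λ : ℕ → Set (EuclideanSpace ℝ (Fin d))} {m : ℕ → ℕ} {κ : ℝ≥0∞}

/-- The mass of `O` is at least the weight of one configuration in it. The hypothesis on
`longCycleSquares` requires the trial configurations to saturate `Q ≤ Y²` asymptotically. -/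
lemma eventually_le_unnormalizedLaw_of_tendsto (hβ : 0 < β)
    (hvol : Tendsto (fun n => volume.real (Λ n)) atTop atTop)
    {O : Set (ℝ≥0 × ℝ≥0)} (hO : IsOpen O) {z : ℝ≥0 × ℝ≥0} (hz : z ∈ O) {c l : ℝ}
    (hc : β * c < l + β * energyGain μ a b z) (N : ℕ → CycleCounts)
    (hN₁ : Tendsto (fun n => ((pairDensity (Λ n) (m n) (N n)).1 : ℝ)) atTop (𝓝 z.1))
    (hN₂ : Tendsto (fun n => ((pairDensity (Λ n) (m n) (N n)).2 : ℝ)) atTop (𝓝 z.2))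
    (hN₃ : Tendsto (fun n => longCycleSquares (Λ n) (m n) (N n)) atTop (𝓝 ((z.2 : ℝ) ^ 2)))
    (hN₄ : Tendsto (fun n => Real.log (cycleWeight (fun k => volume.real (Λ n) * q d β k) (N n))
      / volume.real (Λ n)) atTop (𝓝 l)) :
    ∀ᶠ n in atTop, ENNReal.ofReal (Real.exp (β * volume.real (Λ n) * c))
      ≤ unnormalizedLaw β μ a b (Λ n) (m n) O := by
  have hpair : Tendsto (fun n => pairDensity (Λ n) (m n) (N n)) atTop (𝓝 z) :=
    (NNReal.tendsto_coe.1 hN₁).prodMk_nhds (NNReal.tendsto_coe.1 hN₂)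
  have hlim := hN₄.add ((((hN₁.add hN₂).const_mul μ).sub
    (((hN₁.add hN₂).pow 2).const_mul (a / 2)) |>.add (hN₃.const_mul (b / 2))).const_mul β)
  filter_upwards [hvol.eventually_gt_atTop 0, hpair.eventually_mem (hO.mem_nhds hz),
    hlim.eventually_const_lt hc] with n hV hmem hlt
  classical
  rw [unnormalizedLaw_apply hO.measurableSet]
  refine le_trans ?_ (ENNReal.le_tsum (N n))
  rw [if_pos hmem]
  refine ENNReal.ofReal_le_ofReal ?_
  have hw : 0 < cycleWeight (fun k => volume.real (Λ n) * q d β k) (N n) :=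
    cycleWeight_pos (fun k => mul_pos hV (q_pos hβ k)) _
  rw [gibbsWeight, ← Real.exp_log hw, ← Real.exp_add]
  refine Real.exp_le_exp.2 ?_
  have := mul_lt_mul_of_pos_left hlt hV
  rw [mul_add, mul_div_cancel₀ _ hV.ne'] at this
  linarith

/-- Moves `z` to a point where the trial configurations exist: a positive short density for the
truncated profile, and a long density that is zero or strictly above `κ`, so that the giant cycle
eventually clears the cut-off. As `freeEnergy` is antitone, continuity of `energyGain` is enough. -/
lemma exists_perturbation (hβ : 0 < β) {O : Set (ℝ≥0 × ℝ≥0)} (hO : IsOpen O)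
    {z : ℝ≥0 × ℝ≥0} (hz : z ∈ O) (hzK : z ∈ K κ) {c : ℝ}
    (hc : c < pressureFunctional d β μ a b z) :
    ∃ w ∈ O, 0 < w.1 ∧ (w.2 = 0 ∨ κ < w.2) ∧ c < pressureFunctional d β μ a b w := by
  -- A zero second coordinate stays zero: when `κ > 0`, a small increase would leave `K κ`.
  set f : ℝ≥0 → ℝ≥0 × ℝ≥0 := fun δ => (z.1 + δ, if z.2 = 0 then 0 else z.2 + δ) with hf
  have hfc : Continuous f := by
    refine (by fun_prop : Continuous fun δ : ℝ≥0 => z.1 + δ).prodMk ?_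
    split_ifs <;> fun_prop
  have hf0 : f 0 = z := by
    refine Prod.ext (by simp [hf]) ?_
    by_cases h : z.2 = 0 <;> simp [hf, h]
  have h1 : ∀ᶠ δ in 𝓝 0, f δ ∈ O :=
    hfc.continuousAt.eventually_mem (by rw [hf0]; exact hO.mem_nhds hz)
  have h2 : ∀ᶠ δ in 𝓝 0, c + freeEnergy d β z.1 < energyGain μ a b (f δ) := by
    refine (continuous_energyGain.comp hfc).continuousAt.eventually_const_lt ?_
    simp only [Function.comp, hf0]
    unfold pressureFunctional at hc
    linarith
  obtain ⟨δ, ⟨hδ1, hδ2⟩, hδ⟩ :=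
    (((h1.and h2).filter_mono nhdsWithin_le_nhds).and (self_mem_nhdsWithin (s := Set.Ioi 0))).exists
  have hδ' : 0 < δ := hδ
  refine ⟨f δ, hδ1, add_pos_of_nonneg_of_pos zero_le hδ', ?_, ?_⟩
  · by_cases h : z.2 = 0
    · simp [hf, h]
    · right
      have hκ : κ ≤ z.2 := hzK.resolve_left h
      simp only [hf, h, if_false]
      refine hκ.trans_lt ?_
      exact_mod_cast lt_add_of_pos_right z.2 hδ'
  · have : freeEnergy d β (f δ).1 ≤ freeEnergy d β z.1 :=
      freeEnergy_antitone hβ z.1.coe_nonneg (NNReal.coe_le_coe.2 (le_add_of_nonneg_right zero_le))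
    unfold pressureFunctional
    linarith

theorem eventually_le_unnormalizedLaw (hd : 1 ≤ d) (hβ : 0 < β)
    (hvol : Tendsto (fun n => volume.real (Λ n)) atTop atTop) (hm : Tendsto m atTop atTop)
    (hκ : Tendsto (fun n => (m n : ℝ≥0∞) / volume (Λ n)) atTop (𝓝 κ))
    {O : Set (ℝ≥0 × ℝ≥0)} (hO : IsOpen O) {z : ℝ≥0 × ℝ≥0} (hz : z ∈ O) (hzK : z ∈ K κ) {c : ℝ}
    (hc : c < pressureFunctional d β μ a b z) :
    ∀ᶠ n in atTop, ENNReal.ofReal (Real.exp (β * volume.real (Λ n) * c))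
      ≤ unnormalizedLaw β μ a b (Λ n) (m n) O := by
  obtain ⟨w, hwO, hw1, hw2, hcw⟩ := exists_perturbation hβ hO hz hzK hc
  obtain ⟨L, s, hx, hs⟩ := exists_truncated_profile (d := d) hd hβ (NNReal.coe_pos.2 hw1)
    (half_pos (mul_pos hβ (sub_pos.2 hcw)))
  set t : ℕ+ → ℝ := fun k => q d β k * Real.exp (β * s * k) with ht
  have htpos : ∀ k, 0 < t k := fun k => mul_pos (q_pos hβ k) (Real.exp_pos _)
  set l := ∑ k ∈ Finset.Icc 1 L, (t k * Real.log (q d β k / t k) + t k) with hl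
  -- For `t_k = q_k e^{βsk}` the Stirling limit becomes `t_k (1 - βsk)`, and `∑ k t_k` is the
  -- density `w.1`.
  have hl' : l = ∑ k ∈ Finset.Icc 1 L, t k - β * s * w.1 := by
    rw [← hx, Finset.mul_sum, ← Finset.sum_sub_distrib]
    refine Finset.sum_congr rfl fun k _ => ?_
    have : q d β k / t k = Real.exp (-(β * s * k)) := by
      rw [Real.exp_neg]
      have := (q_pos (d := d) hβ k).ne'
      simp only [ht]
      field_simp
    rw [this, Real.log_exp]
    ring
  have hcl : β * c < l + β * energyGain μ a b w := by
    have := mul_pos hβ (sub_pos.2 hcw)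
    unfold pressureFunctional at hs this
    rw [hl']
    linarith
  have hLm : ∀ᶠ n in atTop, (L : ℕ) < m n := hm.eventually_gt_atTop _
  have hX : Tendsto (fun n => ((pairDensity (Λ n) (m n)
      (shortCycles t L (volume.real (Λ n)))).1 : ℝ)) atTop (𝓝 w.1) := by
    have h : Tendsto (fun V : ℝ => ∑ k ∈ Finset.Icc 1 L, (k : ℝ) * (⌊t k * V⌋₊ / V)) atTop
        (𝓝 (∑ k ∈ Finset.Icc 1 L, (k : ℝ) * t k)) :=
      tendsto_finsetSum _ fun k _ =>
        (tendsto_nat_floor_mul_div_atTop (htpos k).le).const_mul _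
    rw [hx] at h
    refine (h.comp hvol).congr' ?_
    filter_upwards [hLm] with n hn
    exact (pairDensity_shortCycles_fst hn).symm
  have hW := (tendsto_log_cycleWeight_shortCycles (d := d) hβ htpos L).comp hvol
  rcases hw2 with hw2 | hw2
  · refine eventually_le_unnormalizedLaw_of_tendsto hβ hvol hO hwO hcl
      (fun n => shortCycles t L (volume.real (Λ n))) hX ?_ ?_ hW
    · rw [hw2]
      refine tendsto_const_nhds.congr' ?_
      filter_upwards [hLm] with n hn
      exact (pairDensity_shortCycles_snd hn).symm
    · rw [hw2, NNReal.coe_zero, zero_pow two_ne_zero]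
      refine tendsto_const_nhds.congr' ?_
      filter_upwards [hLm] with n hn
      exact (longCycleSquares_shortCycles hn).symm
  · have hy : (0 : ℝ) < w.2 := by
      have : (0 : ℝ≥0∞) < w.2 := pos_of_gt hw2
      exact_mod_cast this
    -- The length of the one giant cycle. The default value of `toPNat'` at `0` plays no role once
    -- the volume is positive.
    set k : ℕ → ℕ+ := fun n => (⌈(w.2 : ℝ) * volume.real (Λ n)⌉₊).toPNat' with hk
    have hkc : ∀ᶠ n in atTop, (k n : ℕ) = ⌈(w.2 : ℝ) * volume.real (Λ n)⌉₊ := by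
      filter_upwards [hvol.eventually_gt_atTop 0] with n hV
      rw [hk, Nat.toPNat'_coe, if_pos (Nat.ceil_pos.2 (mul_pos hy hV))]
    have hmk : ∀ᶠ n in atTop, m n ≤ (k n : ℕ) := by
      filter_upwards [hvol.eventually_gt_atTop 0, hκ.eventually_lt_const hw2, hkc]
        with n hV hlt hkn
      have h := ENNReal.toReal_strict_mono ENNReal.coe_ne_top hlt
      rw [ENNReal.toReal_div, ENNReal.toReal_natCast, ENNReal.coe_toReal] at h
      rw [hkn, ← Nat.cast_le (α := ℝ)]
      exact ((div_lt_iff₀ hV).1 h).le.trans (Nat.le_ceil _)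
    have hky : Tendsto (fun n => ((k n : ℕ) : ℝ) / volume.real (Λ n)) atTop (𝓝 w.2) := by
      refine ((tendsto_nat_ceil_mul_div_atTop hy.le).comp hvol).congr' ?_
      filter_upwards [hkc] with n hn
      rw [hn]; rfl
    refine eventually_le_unnormalizedLaw_of_tendsto hβ hvol hO hwO hcl
      (fun n => shortCycles t L (volume.real (Λ n)) + Finsupp.single (k n) 1) ?_ ?_ ?_ ?_
    · refine hX.congr' ?_
      filter_upwards [hmk] with n hn
      exact (pairDensity_add_single_fst hn _).symm
    · refine hky.congr' ?_
      filter_upwards [hLm, hmk] with n hL hn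
      rw [pairDensity_add_single_snd hn, pairDensity_shortCycles_snd hL, zero_add]
    · refine (hky.pow 2).congr' ?_
      filter_upwards [hLm, hmk] with n hL hn
      exact (longCycleSquares_shortCycles_add_single hL hn).symm
    · have h := hW.add ((tendsto_log_single_cycle d hβ hy).comp hvol)
      rw [add_zero] at h
      refine h.congr' ?_
      filter_upwards [hLm, hmk, hvol.eventually_gt_atTop 0] with n hL hn hV
      have hq : 0 < volume.real (Λ n) * q d β (k n) := mul_pos hV (q_pos hβ _)
      rw [cycleWeight_shortCycles_add_single _ (PNat.coe_lt_coe _ _ |>.1 (hL.trans_le hn)),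
        Real.log_mul (cycleWeight_pos (fun k => mul_pos hV (q_pos hβ k)) _).ne' hq.ne', add_div]
      rfl

end Sequence

end HYL

namespace HYL

/-! ### The pressure and the rate function -/

variable {d : ℕ} {β α μ a b : ℝ} {κ : ℝ≥0∞}

/-- The limiting pressure, as a supremum of real numbers. -/
noncomputable def limitPressure (d : ℕ) (β μ a b : ℝ) (κ : ℝ≥0∞) : ℝ :=
  sSup (pressureFunctional d β μ a b '' K κ)

lemma isLUB_limitPressure (hβ : 0 < β) (hb : 0 < b) (hab : b < a) :
    IsLUB (pressureFunctional d β μ a b '' K κ) (limitPressure d β μ a b κ) := by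
  refine isLUB_csSup ⟨_, 0, .inl rfl, rfl⟩ ⟨μ ^ 2 / (2 * (a - b)) + idealPressure d β 0, ?_⟩
  rintro _ ⟨z, -, rfl⟩
  have h1 := energyGain_le_const (μ := μ) hb hab z
  have h2 := neg_idealPressure_zero_le_freeEnergy (d := d) hβ z.1.coe_nonneg
  unfold pressureFunctional
  linarith

lemma pressureFunctional_le_limitPressure (hβ : 0 < β) (hb : 0 < b) (hab : b < a)
    {z : ℝ≥0 × ℝ≥0} (hz : z ∈ K κ) :
    pressureFunctional d β μ a b z ≤ limitPressure d β μ a b κ :=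
  (isLUB_limitPressure hβ hb hab).1 ⟨z, hz, rfl⟩

lemma exists_lt_pressureFunctional (hβ : 0 < β) (hb : 0 < b) (hab : b < a) {c : ℝ}
    (hc : c < limitPressure d β μ a b κ) :
    ∃ z ∈ K κ, c < pressureFunctional d β μ a b z := by
  obtain ⟨_, ⟨z, hz, rfl⟩, h⟩ := (lt_isLUB_iff (isLUB_limitPressure hβ hb hab)).1 hc
  exact ⟨z, hz, h⟩

lemma coe_limitPressure (hd : 1 ≤ d) (hβ : 0 < β) (hb : 0 < b) (hab : b < a) :
    (limitPressure d β μ a b κ : EReal) = ⨆ z ∈ K κ,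
      (((μ * (z.1 + z.2) - a / 2 * (z.1 + z.2) ^ 2 + b / 2 * z.2 ^ 2 : ℝ) : EReal)
        - f₀ d β z.1) := by
  have h : ∀ z : ℝ≥0 × ℝ≥0,
      (((μ * (z.1 + z.2) - a / 2 * (z.1 + z.2) ^ 2 + b / 2 * z.2 ^ 2 : ℝ) : EReal)
        - f₀ d β z.1) = (pressureFunctional d β μ a b z : EReal) := fun z => by
    rw [f₀_eq_freeEnergy hd hβ z.1.coe_nonneg, ← EReal.coe_sub]; rfl
  simp_rw [h]
  refine le_antisymm (EReal.ge_of_forall_gt_iff_ge.1 fun c hc => ?_) (iSup₂_le fun z hz =>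
    EReal.coe_le_coe_iff.2 (pressureFunctional_le_limitPressure hβ hb hab hz))
  obtain ⟨z, hz, hlt⟩ := exists_lt_pressureFunctional hβ hb hab (EReal.coe_lt_coe_iff.1 hc)
  exact (EReal.coe_le_coe_iff.2 hlt.le).trans
    (le_iSup₂ (f := fun z (_ : z ∈ K κ) => (pressureFunctional d β μ a b z : EReal)) z hz)

lemma rateFunction_of_mem (hd : 1 ≤ d) (hβ : 0 < β) (p : ℝ) {z : ℝ≥0 × ℝ≥0} (hz : z ∈ K κ) :
    rateFunction d β μ a b κ p z = ((p - pressureFunctional d β μ a b z : ℝ) : EReal) := by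
  rw [rateFunction, if_pos hz, f₀_eq_freeEnergy hd hβ z.1.coe_nonneg, ← EReal.coe_add]
  congr 1
  unfold pressureFunctional energyGain
  ring

lemma rateFunction_of_notMem (p : ℝ) {z : ℝ≥0 × ℝ≥0} (hz : z ∉ K κ) :
    rateFunction d β μ a b κ p z = ⊤ := if_neg hz

lemma isClosed_K : IsClosed (K κ) :=
  (isClosed_eq continuous_snd continuous_const).union
    (isClosed_le continuous_const (ENNReal.continuous_coe.comp continuous_snd))

/-- Upper semicontinuity: `freeEnergy` is a supremum of continuous functions of the density, so the
complement is a union of open sets indexed by the slopes `s ≤ 0`. -/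
lemma isClosed_le_pressureFunctional (hβ : 0 < β) (c : ℝ) :
    IsClosed {z | c ≤ pressureFunctional d β μ a b z} := by
  rw [← isOpen_compl_iff]
  have : {z | c ≤ pressureFunctional d β μ a b z}ᶜ
      = ⋃ s ∈ Set.Iic (0 : ℝ), {z : ℝ≥0 × ℝ≥0 |
          energyGain μ a b z - c < s * z.1 - idealPressure d β s} := by
    ext z
    simp only [Set.mem_compl_iff, Set.mem_ofPred_eq, not_le, Set.mem_iUnion, exists_prop,
      Set.mem_Iic]
    constructor
    · intro h
      exact exists_lt_of_lt_freeEnergy (by unfold pressureFunctional at h; linarith)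
    · rintro ⟨s, hs, h⟩
      have := le_freeEnergy (d := d) hβ z.1.coe_nonneg hs
      unfold pressureFunctional
      linarith
  rw [this]
  exact isOpen_biUnion fun s _ => isOpen_lt (by fun_prop) (by fun_prop)

lemma rateFunction_sublevel (hd : 1 ≤ d) (hβ : 0 < β) (p c : ℝ) :
    {z | rateFunction d β μ a b κ p z ≤ (c : EReal)}
      = K κ ∩ {z | p - c ≤ pressureFunctional d β μ a b z} := by
  ext z
  by_cases hz : z ∈ K κ
  · simp only [Set.mem_ofPred_eq, Set.mem_inter_iff, hz, true_and, rateFunction_of_mem hd hβ p hz,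
      EReal.coe_le_coe_iff]
    exact sub_le_comm
  · simp [hz, rateFunction_of_notMem p hz]

lemma rateFunction_nonneg (hd : 1 ≤ d) (hβ : 0 < β) (hb : 0 < b) (hab : b < a)
    (z : ℝ≥0 × ℝ≥0) : 0 ≤ rateFunction d β μ a b κ (limitPressure d β μ a b κ) z := by
  by_cases hz : z ∈ K κ
  · rw [rateFunction_of_mem hd hβ _ hz]
    exact EReal.coe_nonneg.2 (sub_nonneg.2 (pressureFunctional_le_limitPressure hβ hb hab hz))
  · rw [rateFunction_of_notMem _ hz]
    exact le_top

lemma isGoodRateFunction_rateFunction (hd : 1 ≤ d) (hβ : 0 < β) (hb : 0 < b) (hab : b < a) :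
    IsGoodRateFunction (rateFunction d β μ a b κ (limitPressure d β μ a b κ)) := by
  have hclosed : ∀ c : ℝ, IsClosed
      {z | rateFunction d β μ a b κ (limitPressure d β μ a b κ) z ≤ (c : EReal)} := fun c => by
    rw [rateFunction_sublevel hd hβ]
    exact isClosed_K.inter (isClosed_le_pressureFunctional hβ _)
  refine ⟨rateFunction_nonneg hd hβ hb hab,
    lowerSemicontinuous_iff_isClosed_preimage.2 fun c => ?_, fun c => ?_⟩
  · induction c with
    | bot =>
      convert isClosed_empty
      ext z
      simpa using (EReal.bot_lt_zero.trans_le (rateFunction_nonneg hd hβ hb hab z)).ne'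
    | coe c => exact hclosed c
    | top => simp
  -- Beyond `R` the functional is at most `p - c - 1`; the extra `1` makes the contradiction with
  -- membership in the sublevel set strict.
  · obtain ⟨R, hR⟩ := exists_energyGain_le (μ := μ) hb hab
      (limitPressure d β μ a b κ - c - idealPressure d β 0 - 1)
    refine (isCompact_Icc (a := (0 : ℝ≥0 × ℝ≥0))
      (b := (R.toNNReal, R.toNNReal))).of_isClosed_subset (hclosed c) ?_
    rw [rateFunction_sublevel hd hβ]
    rintro z ⟨-, hz⟩
    have h1 := neg_idealPressure_zero_le_freeEnergy (d := d) hβ z.1.coe_nonneg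
    have hlt : (z.1 : ℝ) + z.2 < R := by
      by_contra! h
      have := hR z h
      simp only [Set.mem_ofPred_eq, pressureFunctional] at hz
      linarith
    have hX := z.1.coe_nonneg
    have hY := z.2.coe_nonneg
    refine ⟨zero_le, Prod.mk_le_mk.2 ⟨?_, ?_⟩⟩ <;> apply NNReal.le_toNNReal_of_coe_le <;> linarith

/-! ### The thermodynamic limit and the large deviation principle -/

lemma inv_mul_log_le {s c : ℝ} (hs : 0 < s) {P : ℝ≥0∞}
    (h : P ≤ ENNReal.ofReal (Real.exp (s * c))) :
    ((s⁻¹ : ℝ) : EReal) * ENNReal.log P ≤ c := by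
  have h1 : ENNReal.log P ≤ ((s * c : ℝ) : EReal) := by
    refine (ENNReal.log_monotone h).trans ?_
    rw [ENNReal.log_ofReal_of_pos (Real.exp_pos _), Real.log_exp]
  refine (mul_le_mul_of_nonneg_left h1 (EReal.coe_nonneg.2 (inv_pos.2 hs).le)).trans ?_
  rw [← EReal.coe_mul, inv_mul_cancel_left₀ hs.ne']

lemma le_inv_mul_log {s c : ℝ} (hs : 0 < s) {P : ℝ≥0∞}
    (h : ENNReal.ofReal (Real.exp (s * c)) ≤ P) :
    (c : EReal) ≤ ((s⁻¹ : ℝ) : EReal) * ENNReal.log P := by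
  have h1 : ((s * c : ℝ) : EReal) ≤ ENNReal.log P := by
    refine le_trans ?_ (ENNReal.log_monotone h)
    rw [ENNReal.log_ofReal_of_pos (Real.exp_pos _), Real.log_exp]
  refine le_trans ?_ (mul_le_mul_of_nonneg_left h1 (EReal.coe_nonneg.2 (inv_pos.2 hs).le))
  rw [← EReal.coe_mul, inv_mul_cancel_left₀ hs.ne']

section Sequence

variable {Λ : ℕ → Set (EuclideanSpace ℝ (Fin d))} {m : ℕ → ℕ}

lemma eventually_partitionFunction_le (hd : 1 ≤ d) (hβ : 0 < β) (hα : α ≤ 0) (hb : 0 < b)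
    (hab : b < a) (hvol : Tendsto (fun n => volume.real (Λ n)) atTop atTop)
    (hm : Tendsto m atTop atTop)
    (hκ : Tendsto (fun n => (m n : ℝ≥0∞) / volume (Λ n)) atTop (𝓝 κ)) {c : ℝ}
    (hc : limitPressure d β μ a b κ < c) :
    ∀ᶠ n in atTop, partitionFunction β α μ a b (Λ n) (m n)
      ≤ Real.exp (β * volume.real (Λ n) * c) := by
  filter_upwards [hvol.eventually_gt_atTop 0, eventually_unnormalizedLaw_le hd hβ hb hab hvol hm hκ
    isClosed_univ hc fun z _ hz => pressureFunctional_le_limitPressure hβ hb hab hz] with n hV hn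
  rwa [unnormalizedLaw_univ hd hβ hα hb hab hV,
    ENNReal.ofReal_le_ofReal_iff (Real.exp_nonneg _)] at hn

lemma eventually_le_partitionFunction (hd : 1 ≤ d) (hβ : 0 < β) (hα : α ≤ 0) (hb : 0 < b)
    (hab : b < a) (hvol : Tendsto (fun n => volume.real (Λ n)) atTop atTop)
    (hm : Tendsto m atTop atTop)
    (hκ : Tendsto (fun n => (m n : ℝ≥0∞) / volume (Λ n)) atTop (𝓝 κ)) {c : ℝ}
    (hc : c < limitPressure d β μ a b κ) :
    ∀ᶠ n in atTop, Real.exp (β * volume.real (Λ n) * c)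
      ≤ partitionFunction β α μ a b (Λ n) (m n) := by
  obtain ⟨z, hz, hlt⟩ := exists_lt_pressureFunctional hβ hb hab hc
  filter_upwards [hvol.eventually_gt_atTop 0, eventually_le_unnormalizedLaw hd hβ hvol hm hκ
    isOpen_univ (Set.mem_univ z) hz hlt] with n hV hn
  rwa [unnormalizedLaw_univ hd hβ hα hb hab hV,
    ENNReal.ofReal_le_ofReal_iff (partitionFunction_pos hd hβ hα hb hab).le] at hn

theorem tendsto_log_partitionFunction (hd : 1 ≤ d) (hβ : 0 < β) (hα : α ≤ 0) (hb : 0 < b)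
    (hab : b < a) (hvol : Tendsto (fun n => volume.real (Λ n)) atTop atTop)
    (hm : Tendsto m atTop atTop)
    (hκ : Tendsto (fun n => (m n : ℝ≥0∞) / volume (Λ n)) atTop (𝓝 κ)) :
    Tendsto (fun n => 1 / (β * volume.real (Λ n)) *
      Real.log (partitionFunction β α μ a b (Λ n) (m n))) atTop
      (𝓝 (limitPressure d β μ a b κ)) := by
  refine tendsto_order.2 ⟨fun c hc => ?_, fun c hc => ?_⟩
  · obtain ⟨c', h1, h2⟩ := exists_between hc
    filter_upwards [hvol.eventually_gt_atTop 0,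
      eventually_le_partitionFunction hd hβ hα hb hab hvol hm hκ h2] with n hV hn
    refine h1.trans_le ?_
    rw [one_div_mul_eq_div, le_div_iff₀ (mul_pos hβ hV), mul_comm]
    exact (Real.le_log_iff_exp_le (partitionFunction_pos hd hβ hα hb hab)).2 hn
  · obtain ⟨c', h1, h2⟩ := exists_between hc
    filter_upwards [hvol.eventually_gt_atTop 0,
      eventually_partitionFunction_le hd hβ hα hb hab hvol hm hκ h1] with n hV hn
    refine lt_of_le_of_lt ?_ h2
    rw [one_div_mul_eq_div, div_le_iff₀ (mul_pos hβ hV), mul_comm c']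
    exact (Real.log_le_iff_le_exp (partitionFunction_pos hd hβ hα hb hab)).2 hn

/-- The law is the quotient of `unnormalizedLaw` by its total mass, so exponential bounds for
numerator and denominator are divided. -/
theorem satisfiesLDP_pairLaw (hd : 1 ≤ d) (hβ : 0 < β) (hα : α ≤ 0) (hb : 0 < b)
    (hab : b < a) (hvol : Tendsto (fun n => volume.real (Λ n)) atTop atTop)
    (hm : Tendsto m atTop atTop)
    (hκ : Tendsto (fun n => (m n : ℝ≥0∞) / volume (Λ n)) atTop (𝓝 κ)) :
    SatisfiesLDP (fun n => pairLaw β α μ a b (Λ n) (m n)) (fun n => β * volume.real (Λ n))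
      (rateFunction d β μ a b κ (limitPressure d β μ a b κ)) := by
  set p := limitPressure d β μ a b κ with hp
  refine ⟨fun C hC => ?_, fun O hO => ?_⟩
  · refine EReal.le_of_forall_lt_iff_le.1 fun c hc => ?_
    -- Since `c₀` lies above minus the infimum of the rate function, `p + c₀` bounds the functional
    -- on `C ∩ K κ`. The gap from `c₀` to `c₁` pays for the numerator and the gap from `c₁` to `c`
    -- for the partition function.
    obtain ⟨c₀, h1, h2⟩ := EReal.lt_iff_exists_real_btwn.1 hc
    obtain ⟨c₁, h3, h4⟩ := exists_between (EReal.coe_lt_coe_iff.1 h2)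
    have hle : ∀ z ∈ C, z ∈ K κ → pressureFunctional d β μ a b z ≤ p + c₀ := by
      intro z hz hzK
      have h5 : ⨅ x ∈ C, rateFunction d β μ a b κ p x ≤ rateFunction d β μ a b κ p z :=
        iInf₂_le z hz
      rw [rateFunction_of_mem hd hβ _ hzK] at h5
      have h6 := (EReal.neg_le_neg_iff.2 h5).trans h1.le
      rw [← EReal.coe_neg, EReal.coe_le_coe_iff] at h6
      linarith
    refine limsup_le_of_le (h := ?_)
    filter_upwards [hvol.eventually_gt_atTop 0,
      eventually_unnormalizedLaw_le hd hβ hb hab hvol hm hκ hC (add_lt_add_right h3 p) hle,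
      eventually_le_partitionFunction (α := α) hd hβ hα hb hab hvol hm hκ
        (show p - (c - c₁) < p by linarith)] with n hV hn hZ
    refine inv_mul_log_le (mul_pos hβ hV) ?_
    rw [pairLaw_apply hd hβ hα hb hab hV hC.measurableSet]
    refine ENNReal.div_le_of_le_mul (hn.trans ?_)
    rw [← ENNReal.ofReal_mul (Real.exp_nonneg _)]
    refine ENNReal.ofReal_le_ofReal
      (le_trans (le_of_eq ?_) (mul_le_mul_of_nonneg_left hZ (Real.exp_nonneg _)))
    rw [← Real.exp_add]
    ring_nf
  · refine EReal.ge_of_forall_gt_iff_ge.1 fun c hc => ?_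
    have hinf := EReal.lt_neg_comm.1 hc
    simp only [iInf_lt_iff, exists_prop] at hinf
    obtain ⟨z, hz, hlt⟩ := hinf
    have hzK : z ∈ K κ := by
      by_contra h
      rw [rateFunction_of_notMem _ h] at hlt
      exact not_top_lt hlt
    rw [rateFunction_of_mem hd hβ _ hzK, ← EReal.coe_neg, EReal.coe_lt_coe_iff] at hlt
    -- The numerator is at least the exponential at rate `c'`. As `c' - c > p`, the partition
    -- function is eventually at most the exponential at rate `c' - c`, leaving rate `c` for the
    -- quotient.
    obtain ⟨c', h1, h2⟩ := exists_between
      (show p + c < pressureFunctional d β μ a b z by linarith)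
    refine le_liminf_of_le (h := ?_)
    filter_upwards [hvol.eventually_gt_atTop 0,
      eventually_le_unnormalizedLaw hd hβ hvol hm hκ hO hz hzK h2,
      eventually_partitionFunction_le (α := α) hd hβ hα hb hab hvol hm hκ
        (show p < c' - c by linarith)] with n hV hn hZ
    refine le_inv_mul_log (mul_pos hβ hV) ?_
    rw [pairLaw_apply hd hβ hα hb hab hV hO.measurableSet, ENNReal.le_div_iff_mul_le
      (.inl (by simpa using partitionFunction_pos hd hβ hα hb hab)) (.inl ENNReal.ofReal_ne_top),
      ← ENNReal.ofReal_mul (Real.exp_nonneg _)]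
    refine le_trans (ENNReal.ofReal_le_ofReal
      ((mul_le_mul_of_nonneg_left hZ (Real.exp_nonneg _)).trans (le_of_eq ?_))) hn
    rw [← Real.exp_add]
    ring_nf

end Sequence

end HYL

theorem mainTheorem1 (d : ℕ) (hd : 1 ≤ d) (β α μ a b : ℝ)
    (hβ : 0 < β) (hα : α < 0) (hb : 0 < b) (hab : b < a)
    (Λ : ℕ → Set (EuclideanSpace ℝ (Fin d))) (hΛ : ∀ n, HYL.IsCentredBox (Λ n))
    (hvol : Tendsto (fun n => volume.real (Λ n)) atTop atTop)
    (m : ℕ → ℕ) (hm : Tendsto m atTop atTop)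
    (κ : ℝ≥0∞) (hκ : Tendsto (fun n => (m n : ℝ≥0∞) / volume (Λ n)) atTop (𝓝 κ)) :
    (∀ n, IsProbabilityMeasure (HYL.refMeasure β α (Λ n))) ∧
    (∀ n, IsProbabilityMeasure (HYL.pairLaw β α μ a b (Λ n) (m n))) ∧
    ∃ p : ℝ,
      Tendsto (fun n => 1 / (β * volume.real (Λ n)) *
        Real.log (HYL.partitionFunction β α μ a b (Λ n) (m n))) atTop (𝓝 p) ∧
      (p : EReal) = (⨆ z ∈ HYL.K κ,
        (((μ * (z.1 + z.2) - a / 2 * (z.1 + z.2) ^ 2 + b / 2 * z.2 ^ 2 : ℝ) : EReal)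
          - HYL.f₀ d β z.1)) ∧
      HYL.IsGoodRateFunction (HYL.rateFunction d β μ a b κ p) ∧
      HYL.SatisfiesLDP (fun n => HYL.pairLaw β α μ a b (Λ n) (m n))
        (fun n => β * volume.real (Λ n)) (HYL.rateFunction d β μ a b κ p) := by
  exact ⟨fun n => HYL.isProbabilityMeasure_refMeasure hd hβ hα.le,
    fun n => HYL.isProbabilityMeasure_pairLaw hd hβ hα.le hb hab,
    HYL.limitPressure d β μ a b κ,
    HYL.tendsto_log_partitionFunction hd hβ hα.le hb hab hvol hm hκ,
    HYL.coe_limitPressure hd hβ hb hab,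
    HYL.isGoodRateFunction_rateFunction hd hβ hb hab,
    HYL.satisfiesLDP_pairLaw hd hβ hα.le hb hab hvol hm hκ⟩
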